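/- Let $m\ge 1$, let $n$ be even and let $0\le p\le 1/2$. Let $A$ be a random $m\times n$ matrix with i.i.d. Bernoulli$(p)$ entries, let $P$ be the event that every row of $A$ has an even sum, and let $Z_0$ be the number of vectors $u\in\{-1,1\}^n$ with $\sum_{i} u_i=0$ and $Au=0$. There exist universal constants $C>0$ and $c>0$ such that the following holds for all sequences $n=n(m)$ (even) and $p=p(m)\in[0,1/2]$ with $n\ge C\,m\log m$ for all large $m$ and $np\to\infty$ as $m\to\infty$; all asymptotic notation refers to $m\to\infty$. (i) If $m=o(np)$, then $\dfrac{\mathbb E[Z_0^2\mid P]}{\mathbb E[Z_0\mid P]^2}=1+o(1)$. (ii) If $m=\Omega(np)$, that is, $m\ge c_0\,np$ for some constant $c_0>0$ and all large $m$, then $\dfrac{\mathbb E[Z_0^2\mid P]}{\mathbb E[Z_0\mid P]^2}\ge \exp\!\left(c\,\dfrac{m}{np}\right)$ for all sufficiently large $m$; that is, the ratio is $\exp(\Omega(m/(np)))$. Consequently the plain second moment method succeeds exactly in the dense regime: the ratio tends to $1$ if and only if $m=o(np)$. -/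

import Mathlib

open MeasureTheory ProbabilityTheory Filter Topology Asymptotics

namespace DenseRegime

/-- The law of the `(m, n, p)`-Bernoulli ensemble: an `m × n` integer matrix whose entries are
independent, each equal to `1` with probability `p` and to `0` with probability `1 - p`. -/
noncomputable def bernoulliEnsemble (m n : ℕ) (p : unitInterval) :
    Measure (Fin m → Fin n → ℤ) :=
  Measure.pi fun _ => Measure.pi fun _ => bernoulliMeasure (1 : ℤ) 0 p

/-- The set of balanced vectors: the `u ∈ {-1, 1}ⁿ` whose coordinates sum to zero. -/
def balanced (n : ℕ) : Finset (Fin n → ℤ) :=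
  (Fintype.piFinset fun _ => ({-1, 1} : Finset ℤ)).filter fun u => ∑ i, u i = 0

/-- `Z r A` is the number of balanced vectors `u` with `‖A u‖_∞ ≤ r`
(the norm on `Fin m → ℤ` is the sup norm). -/
noncomputable def Z {m n : ℕ} (r : ℝ) (A : Fin m → Fin n → ℤ) : ℕ :=
  Set.ncard {u : Fin n → ℤ | u ∈ balanced n ∧ ‖(Matrix.of A).mulVec u‖ ≤ r}

/-- The event `P` that every row of the matrix has an even sum. -/
def evenRows (m n : ℕ) : Set (Fin m → Fin n → ℤ) :=
  {A | ∀ i, Even (∑ j, A i j)}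

/-- The conditional expectation `E[X | P]` of `X` given the event `P`, for a matrix drawn from
the `(m, n, p)`-Bernoulli ensemble. -/
noncomputable def expGivenEven (m n : ℕ) (p : unitInterval) (X : (Fin m → Fin n → ℤ) → ℝ) : ℝ :=
  ∫ A, X A ∂(ProbabilityTheory.cond (bernoulliEnsemble m n p) (evenRows m n))

/-- The second moment ratio `E[Z_0² | P] / E[Z_0 | P]²`. -/
noncomputable def secondMomentRatio (m n : ℕ) (p : unitInterval) : ℝ :=
  expGivenEven m n p (fun A => (Z 0 A : ℝ) ^ 2) / expGivenEven m n p (fun A => (Z 0 A : ℝ)) ^ 2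

end DenseRegime

namespace DenseRegime

open scoped Real

/-! Write n = 2h, s = 2p(1-p), T = 2sh, and f(t) for `arcsineMoment s t`. For an integer k, f(k) is
the probability that two independent Bin(k, p) variables agree. If balanced u, v are both +1 on
exactly k coordinates, then (u+v)/2 and (u-v)/2 have disjoint supports, so a random row is
orthogonal to both with probability f(k) f(h-k). Orthogonality to one balanced vector already forces
an even row sum, so conditioning only rescales. With e the probability of an even row sum and w_k
the hypergeometric overlap weights, the ratio is Σ_k w_k (e f(k) f(h-k) / f(h)²)^m
(`secondMomentRatio_eq`).

Everything then rests on the expansion f(t) ≈ (2πst)^(-1/2) (1 + c/(2st)) with c between 1/4 - 3s/2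
and 1/4 (`arcsineMoment_le`, `le_arcsineMoment`).

Lower bounds: f is log-convex, so f(k) f(h-k) ≥ f(h/2)² for every k, and e ≥ 1/2; each base is at
least f(h/2)² / (2 f(h)²). This is 1 - O(1/T) in general, and exceeds 1 by order 1/T when s is
small. As T is comparable to np, the m-th power gives exp(Ω(m/(np))). If np = O(m), then n ≥ C m log
m forces p to be small, so the gain is available.

Upper bound: with δ = (2k-h)/h, a central base is at most exp(O(1/T) + δ²). The variance of δ is
1/(2h-1), so the factor exp(mδ²) averages to 1 + O(m/h) plus small tails. Far from the centre, h ≫ m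
log h makes the Gaussian decay of w_k beat the crude bound (16h)^m. -/

/-- The `t`-th moment of `1 - 2 s ξ` for an arcsine distributed `ξ`, written as the average of
`(1 - 2 s sin² φ) ^ t` over a quarter period. -/
noncomputable def arcsineMoment (s t : ℝ) : ℝ :=
  2 / π * ∫ φ in (0 : ℝ)..π / 2, (1 - 2 * s * Real.sin φ ^ 2) ^ t

/-! ### Gaussian moments on the half-line -/

theorem integrableOn_pow_mul_exp_neg_mul_sq {T : ℝ} (hT : 0 < T) (k : ℕ) :
    IntegrableOn (fun u : ℝ => u ^ k * Real.exp (-T * u ^ 2)) (Set.Ioi 0) := by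
  have h := (integrable_rpow_mul_exp_neg_mul_sq hT (s := (k : ℝ))
    (by linarith [k.cast_nonneg (α := ℝ)])).integrableOn (s := Set.Ioi 0)
  simpa only [Real.rpow_natCast] using h

theorem integral_pow_add_two_mul_exp_neg_mul_sq {T : ℝ} (hT : 0 < T) (k : ℕ) :
    ∫ u in Set.Ioi (0 : ℝ), u ^ (k + 2) * Real.exp (-T * u ^ 2) =
      (k + 1) / (2 * T) * ∫ u in Set.Ioi (0 : ℝ), u ^ k * Real.exp (-T * u ^ 2) := by
  have key : ∀ j : ℕ, ∫ u in Set.Ioi (0 : ℝ), u ^ j * Real.exp (-T * u ^ 2) =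
      T ^ (-((j : ℝ) + 1) / 2) * (1 / 2) * Real.Gamma (((j : ℝ) + 1) / 2) := by
    intro j
    have := integral_rpow_mul_exp_neg_mul_rpow (p := 2) (q := (j : ℝ)) (b := T) (by norm_num)
      (by linarith [j.cast_nonneg (α := ℝ)]) hT
    rw [← this]
    refine setIntegral_congr_fun measurableSet_Ioi fun u _ => ?_
    simp [Real.rpow_natCast]
  rw [key, key]
  have h1 : (((k + 2 : ℕ) : ℝ) + 1) / 2 = ((k : ℝ) + 1) / 2 + 1 := by push_cast; ring
  have h2 : -(((k + 2 : ℕ) : ℝ) + 1) / 2 = -((k : ℝ) + 1) / 2 + (-1) := by push_cast; ring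
  rw [h1, h2, Real.Gamma_add_one (by positivity), Real.rpow_add hT, Real.rpow_neg_one]
  field_simp

theorem integral_sq_mul_exp_neg_mul_sq {T : ℝ} (hT : 0 < T) :
    ∫ u in Set.Ioi (0 : ℝ), u ^ 2 * Real.exp (-T * u ^ 2) = 1 / (2 * T) * (√(π / T) / 2) := by
  have := integral_pow_add_two_mul_exp_neg_mul_sq hT 0
  simp only [pow_zero, one_mul, integral_gaussian_Ioi, zero_add] at this
  simpa using this

theorem integral_pow_four_mul_exp_neg_mul_sq {T : ℝ} (hT : 0 < T) :
    ∫ u in Set.Ioi (0 : ℝ), u ^ 4 * Real.exp (-T * u ^ 2) =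
      3 / (4 * T ^ 2) * (√(π / T) / 2) := by
  have := integral_pow_add_two_mul_exp_neg_mul_sq hT 2
  rw [integral_sq_mul_exp_neg_mul_sq hT] at this
  rw [this]; push_cast; field_simp; norm_num

theorem integral_pow_six_mul_exp_neg_mul_sq {T : ℝ} (hT : 0 < T) :
    ∫ u in Set.Ioi (0 : ℝ), u ^ 6 * Real.exp (-T * u ^ 2) =
      15 / (8 * T ^ 3) * (√(π / T) / 2) := by
  have := integral_pow_add_two_mul_exp_neg_mul_sq hT 4
  rw [integral_pow_four_mul_exp_neg_mul_sq hT] at this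
  rw [this]; push_cast; field_simp; norm_num

/-! ### Pointwise bounds for the integrand -/

theorem base_nonneg {s : ℝ} (hs' : s ≤ 1 / 2) (φ : ℝ) :
    0 ≤ 1 - 2 * s * Real.sin φ ^ 2 := by
  nlinarith [Real.sin_sq_le_one φ, sq_nonneg (Real.sin φ)]

theorem base_le_one {s : ℝ} (hs : 0 ≤ s) (φ : ℝ) : 1 - 2 * s * Real.sin φ ^ 2 ≤ 1 := by
  nlinarith [mul_nonneg hs (sq_nonneg (Real.sin φ))]

theorem continuous_base_rpow (s : ℝ) {t : ℝ} (ht : 0 ≤ t) :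
    Continuous fun φ : ℝ => (1 - 2 * s * Real.sin φ ^ 2) ^ t := by
  refine Continuous.rpow_const (by fun_prop) fun _ => Or.inr ht

theorem one_sub_rpow_le_exp {y t : ℝ} (hy : y ≤ 1) (ht : 0 ≤ t) :
    (1 - y) ^ t ≤ Real.exp (-(t * y)) := by
  calc (1 - y) ^ t ≤ (Real.exp (-y)) ^ t :=
        Real.rpow_le_rpow (by linarith) (by linarith [Real.add_one_le_exp (-y)]) ht
    _ = Real.exp (-(t * y)) := by rw [← Real.exp_mul]; ring_nf

/-- Bernoulli's inequality bounds (1-y²)^t below, while 1 - y² = (1-y)(1+y) ≤ (1-y)e^y bounds it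
above. -/
theorem exp_mul_le_one_sub_rpow {y t : ℝ} (hy : 0 ≤ y) (hy' : y ≤ 1) (ht : 1 ≤ t) :
    Real.exp (-(t * y)) * (1 - t * y ^ 2) ≤ (1 - y) ^ t := by
  have h1 : 1 - t * y ^ 2 ≤ (1 - y ^ 2) ^ t := by
    have := one_add_mul_self_le_rpow_one_add (s := -y ^ 2) (by nlinarith) ht
    calc 1 - t * y ^ 2 = 1 + t * (-y ^ 2) := by ring
      _ ≤ _ := this
      _ = _ := by ring_nf
  have h2 : (1 - y ^ 2) ^ t ≤ (1 - y) ^ t * Real.exp (t * y) := by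
    have : 1 - y ^ 2 ≤ (1 - y) * Real.exp y := by
      nlinarith [Real.add_one_le_exp y]
    calc (1 - y ^ 2) ^ t ≤ ((1 - y) * Real.exp y) ^ t :=
          Real.rpow_le_rpow (by nlinarith) this (by linarith)
      _ = (1 - y) ^ t * Real.exp (t * y) := by
          rw [Real.mul_rpow (by linarith) (Real.exp_pos _).le, ← Real.exp_mul, mul_comm y t]
  calc Real.exp (-(t * y)) * (1 - t * y ^ 2)
      ≤ Real.exp (-(t * y)) * ((1 - y) ^ t * Real.exp (t * y)) := by gcongr; exact h1.trans h2
    _ = (1 - y) ^ t * (Real.exp (-(t * y)) * Real.exp (t * y)) := by ring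
    _ = (1 - y) ^ t := by rw [← Real.exp_add]; simp

/-- The substitution u = sin φ needs a factor cos φ. This bound and the next insert it through
1/√(1-u²) ≈ 1 + u²/2, with error at most u⁴. -/
theorem one_le_cos_mul_add (φ : ℝ) (hφ : 0 ≤ Real.cos φ) :
    1 ≤ (1 + Real.sin φ ^ 2 / 2) * Real.cos φ + Real.sin φ ^ 4 := by
  have hs : Real.sin φ ^ 2 = 1 - Real.cos φ ^ 2 := Real.sin_sq φ
  have h4 : Real.sin φ ^ 4 = (1 - Real.cos φ ^ 2) ^ 2 := by rw [← hs]; ring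
  rw [hs, h4]
  set c := Real.cos φ
  -- This product is exactly the difference of the two sides.
  have : 0 ≤ c * ((c - 1) ^ 2 * (c + 3 / 2)) := by positivity
  nlinarith

theorem cos_mul_le_one (φ : ℝ) (hφ : 0 ≤ Real.cos φ) :
    (1 + Real.sin φ ^ 2 / 2) * Real.cos φ ≤ 1 := by
  have hs : Real.sin φ ^ 2 = 1 - Real.cos φ ^ 2 := Real.sin_sq φ
  rw [hs]
  set c := Real.cos φ
  have : 0 ≤ (c - 1) ^ 2 * (c + 2) := by positivity
  nlinarith

theorem integral_comp_sin_mul_cos {g : ℝ → ℝ} (hg : Continuous g) :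
    ∫ φ in (0 : ℝ)..π / 2, g (Real.sin φ) * Real.cos φ = ∫ u in (0 : ℝ)..1, g u := by
  have := intervalIntegral.integral_comp_mul_deriv (a := 0) (b := π / 2) (f := Real.sin)
    (f' := Real.cos) (g := g) (fun x _ => Real.hasDerivAt_sin x) Real.continuous_cos.continuousOn hg
  simpa using this

theorem intervalIntegral_le_integral_Ioi {g : ℝ → ℝ} {b : ℝ} (hb : 0 ≤ b)
    (hg : IntegrableOn g (Set.Ioi 0)) (h0 : ∀ u, 0 ≤ g u) :
    ∫ u in (0 : ℝ)..b, g u ≤ ∫ u in Set.Ioi (0 : ℝ), g u := by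
  rw [intervalIntegral.integral_of_le hb]
  exact setIntegral_mono_set hg (Eventually.of_forall h0)
    (LE.le.eventuallyLE Set.Ioc_subset_Ioi_self)

theorem cos_nonneg_of_mem {φ : ℝ} (hφ : φ ∈ Set.Icc 0 (π / 2)) : 0 ≤ Real.cos φ :=
  Real.cos_nonneg_of_mem_Icc ⟨by linarith [hφ.1, Real.pi_pos], hφ.2⟩

theorem two_div_pi_mul_sqrt_pi_div {T : ℝ} (hT : 0 < T) :
    2 / π * (√(π / T) / 2) = 1 / √(π * T) := by
  have hpi := Real.pi_pos
  rw [Real.sqrt_div hpi.le, Real.sqrt_mul hpi.le]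
  have := Real.sq_sqrt hpi.le
  have h1 : 0 < √π := by positivity
  have h2 : 0 < √T := by positivity
  field_simp
  linarith

/-! ### Two-term asymptotics of the arcsine moments -/

/-- The integrand is at most exp(-T sin² φ). Inserting cos φ leaves a Gaussian integral in u = sin
φ, which extends to the half-line, and a remainder of order sin⁴ φ. -/
theorem arcsineMoment_le {s t : ℝ} (hs : 0 < s) (hs' : s ≤ 1 / 2) (ht : 0 < t) :
    arcsineMoment s t ≤
      1 / √(π * (2 * s * t)) * (1 + 1 / (4 * (2 * s * t)) + 8 / (2 * s * t) ^ 2) := by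
  set T := 2 * s * t with hTdef
  have hT : 0 < T := by positivity
  have hpi := Real.pi_pos
  -- Jordan's inequality sin φ ≥ 2φ/π turns the rate T in sin² φ into the rate T' in φ².
  set T' := 4 * T / π ^ 2 with hT'def
  have hT' : 0 < T' := by positivity
  have hcont1 : Continuous fun φ : ℝ => (1 + Real.sin φ ^ 2 / 2) * Real.exp (-T * Real.sin φ ^ 2)
      * Real.cos φ := by fun_prop
  have hcont2 : Continuous fun φ : ℝ => φ ^ 4 * Real.exp (-T' * φ ^ 2) := by fun_prop
  have step1 : ∫ φ in (0 : ℝ)..π / 2, (1 - 2 * s * Real.sin φ ^ 2) ^ t ≤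
      ∫ φ in (0 : ℝ)..π / 2, ((1 + Real.sin φ ^ 2 / 2) * Real.exp (-T * Real.sin φ ^ 2)
        * Real.cos φ + φ ^ 4 * Real.exp (-T' * φ ^ 2)) := by
    refine intervalIntegral.integral_mono_on (by positivity)
      ((continuous_base_rpow s ht.le).intervalIntegrable _ _)
      ((hcont1.add hcont2).intervalIntegrable _ _) fun φ hφ => ?_
    have hc := cos_nonneg_of_mem hφ
    have h1 := one_sub_rpow_le_exp (y := 2 * s * Real.sin φ ^ 2) (t := t)
      (by linarith [base_nonneg hs' φ]) ht.le
    have h1' : -(t * (2 * s * Real.sin φ ^ 2)) = -T * Real.sin φ ^ 2 := by rw [hTdef]; ring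
    rw [h1'] at h1
    have h2 := one_le_cos_mul_add φ hc
    have h3 : Real.sin φ ^ 4 * Real.exp (-T * Real.sin φ ^ 2) ≤
        φ ^ 4 * Real.exp (-T' * φ ^ 2) := by
      have hsin0 : 0 ≤ Real.sin φ := Real.sin_nonneg_of_nonneg_of_le_pi hφ.1 (by linarith [hφ.2])
      have hsin1 : Real.sin φ ≤ φ := Real.sin_le hφ.1
      have hsin2 := Real.mul_le_sin hφ.1 hφ.2
      have : T' * φ ^ 2 ≤ T * Real.sin φ ^ 2 := by
        have h5 : (2 / π * φ) ^ 2 ≤ Real.sin φ ^ 2 :=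
          pow_le_pow_left₀ (mul_nonneg (by positivity) hφ.1) hsin2 2
        calc T' * φ ^ 2 = T * (2 / π * φ) ^ 2 := by rw [hT'def]; field_simp; ring
          _ ≤ _ := by gcongr
      refine mul_le_mul (pow_le_pow_left₀ hsin0 hsin1 4) ?_ (Real.exp_pos _).le (by positivity)
      exact Real.exp_le_exp.2 (by linarith)
    calc (1 - 2 * s * Real.sin φ ^ 2) ^ t ≤ Real.exp (-T * Real.sin φ ^ 2) * 1 := by simpa using h1
      _ ≤ Real.exp (-T * Real.sin φ ^ 2) *
          ((1 + Real.sin φ ^ 2 / 2) * Real.cos φ + Real.sin φ ^ 4) := by gcongr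
      _ = (1 + Real.sin φ ^ 2 / 2) * Real.exp (-T * Real.sin φ ^ 2) * Real.cos φ +
          Real.sin φ ^ 4 * Real.exp (-T * Real.sin φ ^ 2) := by ring
      _ ≤ _ := by gcongr
  have step2 : ∫ φ in (0 : ℝ)..π / 2, ((1 + Real.sin φ ^ 2 / 2) *
      Real.exp (-T * Real.sin φ ^ 2) * Real.cos φ) ≤ √(π / T) / 2 * (1 + 1 / (4 * T)) := by
    rw [integral_comp_sin_mul_cos (g := fun u => (1 + u ^ 2 / 2) * Real.exp (-T * u ^ 2))
      (by fun_prop)]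
    have hi0 := integrableOn_pow_mul_exp_neg_mul_sq hT 0
    have hi2 := integrableOn_pow_mul_exp_neg_mul_sq hT 2
    have heq : (fun u : ℝ => (1 + u ^ 2 / 2) * Real.exp (-T * u ^ 2)) =
        fun u => u ^ 0 * Real.exp (-T * u ^ 2) + 1 / 2 * (u ^ 2 * Real.exp (-T * u ^ 2)) := by
      funext u; ring
    refine (intervalIntegral_le_integral_Ioi zero_le_one ?_ fun u => by positivity).trans ?_
    · rw [heq]; exact hi0.add (hi2.const_mul _)
    · rw [heq, integral_add hi0 (hi2.const_mul _), integral_const_mul,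
        integral_sq_mul_exp_neg_mul_sq hT]
      simp only [pow_zero, one_mul]
      rw [integral_gaussian_Ioi]
      apply le_of_eq; field_simp; ring
  have step3 : ∫ φ in (0 : ℝ)..π / 2, φ ^ 4 * Real.exp (-T' * φ ^ 2) ≤
      √(π / T) / 2 * (8 / T ^ 2) := by
    refine (intervalIntegral_le_integral_Ioi (by positivity)
      (integrableOn_pow_mul_exp_neg_mul_sq hT' 4) fun u => by positivity).trans ?_
    rw [integral_pow_four_mul_exp_neg_mul_sq hT']
    have e1 : √(π / T') = π / 2 * √(π / T) := by
      rw [hT'def, show π / (4 * T / π ^ 2) = (π / 2) ^ 2 * (π / T) by field_simp; ring,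
        Real.sqrt_mul (by positivity), Real.sqrt_sq (by positivity)]
    have e2 : 3 / (4 * T' ^ 2) = 3 * π ^ 4 / 64 / T ^ 2 := by
      rw [hT'def]; field_simp; ring
    rw [e1, e2]
    have hp5 : 3 * π ^ 5 / 128 ≤ 8 := by
      have : π ^ 5 ≤ 3.15 ^ 5 := pow_le_pow_left₀ hpi.le Real.pi_lt_d2.le 5
      norm_num at this ⊢; linarith
    calc 3 * π ^ 4 / 64 / T ^ 2 * (π / 2 * √(π / T) / 2)
        = √(π / T) / 2 * (3 * π ^ 5 / 128 / T ^ 2) := by ring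
      _ ≤ _ := by gcongr
  rw [intervalIntegral.integral_add (hcont1.intervalIntegrable _ _)
    (hcont2.intervalIntegrable _ _)] at step1
  have e3 := two_div_pi_mul_sqrt_pi_div hT
  calc arcsineMoment s t ≤ 2 / π * (√(π / T) / 2 * (1 + 1 / (4 * T)) +
        √(π / T) / 2 * (8 / T ^ 2)) := by
        unfold arcsineMoment
        gcongr
        linarith
    _ = (2 / π * (√(π / T) / 2)) * (1 + 1 / (4 * T) + 8 / T ^ 2) := by ring
    _ = _ := by rw [e3]

/-- The correction -3s/2 is the fourth Gaussian moment weighted by 2sT, the second-order loss in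
(1-y)^t ≈ e^(-ty). -/
theorem le_arcsineMoment {s t : ℝ} (hs : 0 < s) (hs' : s ≤ 1 / 2) (ht : 1 ≤ t) :
    1 / √(π * (2 * s * t)) * (1 + (1 / 4 - 3 / 2 * s) / (2 * s * t) - 3 / (2 * s * t) ^ 2
      - 1 / (2 * s * t) ^ 3) ≤ arcsineMoment s t := by
  set T := 2 * s * t with hTdef
  have hT : 0 < T := by positivity
  have hpi := Real.pi_pos
  have hcont : Continuous fun u : ℝ => (1 + u ^ 2 / 2) * (1 - 2 * s * T * u ^ 4) *
      Real.exp (-T * u ^ 2) := by fun_prop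
  have step1 : ∫ φ in (0 : ℝ)..π / 2, (1 + Real.sin φ ^ 2 / 2) *
      (1 - 2 * s * T * Real.sin φ ^ 4) * Real.exp (-T * Real.sin φ ^ 2) * Real.cos φ ≤
      ∫ φ in (0 : ℝ)..π / 2, (1 - 2 * s * Real.sin φ ^ 2) ^ t := by
    refine intervalIntegral.integral_mono_on (by positivity)
      (Continuous.intervalIntegrable (by fun_prop) _ _)
      ((continuous_base_rpow s (by linarith)).intervalIntegrable _ _) fun φ hφ => ?_
    have hc := cos_nonneg_of_mem hφ
    have h1 := exp_mul_le_one_sub_rpow (y := 2 * s * Real.sin φ ^ 2) (t := t)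
      (by positivity) (by linarith [base_nonneg hs' φ]) ht
    have h1' : -(t * (2 * s * Real.sin φ ^ 2)) = -T * Real.sin φ ^ 2 := by rw [hTdef]; ring
    have h1'' : t * (2 * s * Real.sin φ ^ 2) ^ 2 = 2 * s * T * Real.sin φ ^ 4 := by
      rw [hTdef]; ring
    rw [h1', h1''] at h1
    have h2 := cos_mul_le_one φ hc
    have h3 : 0 ≤ (1 + Real.sin φ ^ 2 / 2) * Real.cos φ := by positivity
    have h4 : 0 ≤ (1 - 2 * s * Real.sin φ ^ 2) ^ t := Real.rpow_nonneg (base_nonneg hs' φ) _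
    calc _ = (Real.exp (-T * Real.sin φ ^ 2) * (1 - 2 * s * T * Real.sin φ ^ 4)) *
          ((1 + Real.sin φ ^ 2 / 2) * Real.cos φ) := by ring
      _ ≤ (1 - 2 * s * Real.sin φ ^ 2) ^ t * ((1 + Real.sin φ ^ 2 / 2) * Real.cos φ) := by gcongr
      _ ≤ (1 - 2 * s * Real.sin φ ^ 2) ^ t * 1 := by gcongr
      _ = _ := mul_one _
  rw [integral_comp_sin_mul_cos hcont] at step1
  -- Raising 2sT to B ≥ 1 makes the integrand nonpositive for u ≥ 1, so extending it to the
  -- half-line can only lower the integral.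
  set B := 1 + 2 * s * T with hB
  have hB1 : 1 ≤ B := by rw [hB]; nlinarith [mul_pos hs hT]
  have hi0 := integrableOn_pow_mul_exp_neg_mul_sq hT 0
  have hi2 := (integrableOn_pow_mul_exp_neg_mul_sq hT 2).const_mul (1 / 2)
  have hi4 := (integrableOn_pow_mul_exp_neg_mul_sq hT 4).const_mul (-B)
  have hi6 := (integrableOn_pow_mul_exp_neg_mul_sq hT 6).const_mul (-(B / 2))
  set q : ℝ → ℝ := fun u => u ^ 0 * Real.exp (-T * u ^ 2) +
    1 / 2 * (u ^ 2 * Real.exp (-T * u ^ 2)) + -B * (u ^ 4 * Real.exp (-T * u ^ 2)) +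
    -(B / 2) * (u ^ 6 * Real.exp (-T * u ^ 2)) with hq
  have hqfac : ∀ u, q u = (1 + u ^ 2 / 2) * (1 - B * u ^ 4) * Real.exp (-T * u ^ 2) := by
    intro u; rw [hq]; ring
  have hqi : IntegrableOn q (Set.Ioi 0) := ((hi0.add hi2).add hi4).add hi6
  have hqint : ∫ u in Set.Ioi (0 : ℝ), q u = √(π / T) / 2 *
      (1 + 1 / (4 * T) - B * (3 / (4 * T ^ 2)) - B * (15 / (16 * T ^ 3))) := by
    have h02 : IntegrableOn (fun u : ℝ => u ^ 0 * Real.exp (-T * u ^ 2) +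
        1 / 2 * (u ^ 2 * Real.exp (-T * u ^ 2))) (Set.Ioi 0) := hi0.add hi2
    have h024 : IntegrableOn (fun u : ℝ => u ^ 0 * Real.exp (-T * u ^ 2) +
        1 / 2 * (u ^ 2 * Real.exp (-T * u ^ 2)) + -B * (u ^ 4 * Real.exp (-T * u ^ 2)))
        (Set.Ioi 0) := h02.add hi4
    rw [hq, integral_add h024 hi6, integral_add h02 hi4, integral_add hi0 hi2, integral_const_mul, integral_const_mul, integral_const_mul,
      integral_sq_mul_exp_neg_mul_sq hT, integral_pow_four_mul_exp_neg_mul_sq hT,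
      integral_pow_six_mul_exp_neg_mul_sq hT]
    simp only [pow_zero, one_mul]
    rw [integral_gaussian_Ioi]
    ring
  have step2 : ∫ u in Set.Ioi (0 : ℝ), q u ≤ ∫ u in (0 : ℝ)..1, (1 + u ^ 2 / 2) *
      (1 - 2 * s * T * u ^ 4) * Real.exp (-T * u ^ 2) := by
    rw [← Set.Ioc_union_Ioi_eq_Ioi (zero_le_one' ℝ), setIntegral_union
      (Set.Ioc_disjoint_Ioi le_rfl) measurableSet_Ioi
      (hqi.mono_set Set.Ioc_subset_Ioi_self) (hqi.mono_set (Set.Ioi_subset_Ioi zero_le_one)),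
      intervalIntegral.integral_of_le zero_le_one]
    have h1 : ∫ u in Set.Ioi (1 : ℝ), q u ≤ 0 := by
      refine setIntegral_nonpos measurableSet_Ioi fun u hu => ?_
      rw [hqfac]
      have hu4 : 1 ≤ u ^ 4 := one_le_pow₀ (le_of_lt hu)
      have : 1 - B * u ^ 4 ≤ 0 := by nlinarith
      have h5 : 0 ≤ (1 + u ^ 2 / 2) * Real.exp (-T * u ^ 2) := by positivity
      nlinarith
    have h2 : ∫ u in Set.Ioc (0 : ℝ) 1, q u ≤ ∫ u in Set.Ioc (0 : ℝ) 1, (1 + u ^ 2 / 2) *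
      (1 - 2 * s * T * u ^ 4) * Real.exp (-T * u ^ 2) := by
      refine setIntegral_mono_on (hqi.mono_set Set.Ioc_subset_Ioi_self)
        ((hcont.intervalIntegrable 0 1).1) measurableSet_Ioc fun u _ => ?_
      rw [hqfac]
      have : 1 - B * u ^ 4 ≤ 1 - 2 * s * T * u ^ 4 := by
        rw [hB]; nlinarith [pow_nonneg (sq_nonneg u) 2]
      gcongr
    linarith
  have e3 := two_div_pi_mul_sqrt_pi_div hT
  have e4 : 1 + (1 / 4 - 3 / 2 * s) / T - 3 / T ^ 2 - 1 / T ^ 3 ≤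
      1 + 1 / (4 * T) - B * (3 / (4 * T ^ 2)) - B * (15 / (16 * T ^ 3)) := by
    have : 1 + 1 / (4 * T) - B * (3 / (4 * T ^ 2)) - B * (15 / (16 * T ^ 3)) =
      1 + (1 / 4 - 3 / 2 * s) / T - (3 / 4 + 15 / 8 * s) / T ^ 2 - (15 / 16) / T ^ 3 := by
      rw [hB]; field_simp; ring
    rw [this]
    have h1 : (3 / 4 + 15 / 8 * s) / T ^ 2 ≤ 3 / T ^ 2 := by gcongr; linarith
    have h2 : (15 / 16) / T ^ 3 ≤ 1 / T ^ 3 := by gcongr; norm_num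
    linarith
  calc _ ≤ 1 / √(π * T) *
        (1 + 1 / (4 * T) - B * (3 / (4 * T ^ 2)) - B * (15 / (16 * T ^ 3))) := by gcongr
    _ = 2 / π * ∫ u in Set.Ioi (0 : ℝ), q u := by rw [hqint, ← e3]; ring
    _ ≤ arcsineMoment s t := by
        unfold arcsineMoment
        gcongr
        exact step2.trans step1

/-! ### Elementary properties of the arcsine moments -/

theorem arcsineMoment_nonneg {s : ℝ} (hs' : s ≤ 1 / 2) (t : ℝ) :
    0 ≤ arcsineMoment s t := by
  have hpi := Real.pi_pos
  refine mul_nonneg (by positivity) (intervalIntegral.integral_nonneg (by positivity) fun φ _ => ?_)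
  exact Real.rpow_nonneg (base_nonneg hs' φ) _

theorem arcsineMoment_pos {s t : ℝ} (hs' : s ≤ 1 / 2) (ht : 0 ≤ t) :
    0 < arcsineMoment s t := by
  have hpi := Real.pi_pos
  refine mul_pos (by positivity) (intervalIntegral.integral_pos (by positivity)
    (continuous_base_rpow s ht).continuousOn
    (fun φ _ => Real.rpow_nonneg (base_nonneg hs' φ) _) ⟨0, ⟨le_rfl, by positivity⟩, by simp⟩)

theorem arcsineMoment_le_one {s t : ℝ} (hs : 0 ≤ s) (hs' : s ≤ 1 / 2) (ht : 0 ≤ t) :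
    arcsineMoment s t ≤ 1 := by
  have hpi := Real.pi_pos
  have : ∫ φ in (0 : ℝ)..π / 2, (1 - 2 * s * Real.sin φ ^ 2) ^ t ≤ ∫ _ in (0 : ℝ)..π / 2, (1 : ℝ) :=
    intervalIntegral.integral_mono_on (by positivity)
      ((continuous_base_rpow s ht).intervalIntegrable _ _) (by simp) fun φ _ =>
        Real.rpow_le_one (base_nonneg hs' φ) (base_le_one hs φ) ht
  unfold arcsineMoment
  calc 2 / π * _ ≤ 2 / π * ∫ _ in (0 : ℝ)..π / 2, (1 : ℝ) := by gcongr
    _ = 1 := by simp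

/-- Log-convexity of the moments at the midpoint. -/
theorem arcsineMoment_half_sq_le {s a b : ℝ} (hs' : s ≤ 1 / 2) (ha : 0 ≤ a) (hb : 0 ≤ b) :
    arcsineMoment s ((a + b) / 2) ^ 2 ≤ arcsineMoment s a * arcsineMoment s b := by
  have hpi := Real.pi_pos
  have hA := arcsineMoment_pos hs' ha
  have hB := arcsineMoment_pos hs' hb
  have hM := arcsineMoment_nonneg hs' ((a + b) / 2)
  set A := arcsineMoment s a with hAd
  set B := arcsineMoment s b with hBd
  set M := arcsineMoment s ((a + b) / 2) with hMd
  have ia := (continuous_base_rpow s ha).intervalIntegrable (μ := volume) 0 (π / 2)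
  have ib := (continuous_base_rpow s hb).intervalIntegrable (μ := volume) 0 (π / 2)
  have im := (continuous_base_rpow s (t := (a + b) / 2) (by positivity)).intervalIntegrable
    (μ := volume) 0 (π / 2)
  -- Cauchy–Schwarz as nonnegativity of a quadratic in l, used below at its minimiser l = M/A.
  have main : ∀ l : ℝ, 2 * l * M ≤ l ^ 2 * A + B := by
    intro l
    have : ∫ φ in (0 : ℝ)..π / 2, 2 * l * (1 - 2 * s * Real.sin φ ^ 2) ^ ((a + b) / 2) ≤
        ∫ φ in (0 : ℝ)..π / 2, (l ^ 2 * (1 - 2 * s * Real.sin φ ^ 2) ^ a +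
          (1 - 2 * s * Real.sin φ ^ 2) ^ b) := by
      refine intervalIntegral.integral_mono_on (by positivity) (im.const_mul _)
        ((ia.const_mul _).add ib) fun φ _ => ?_
      have h0 := base_nonneg hs' φ
      set y := 1 - 2 * s * Real.sin φ ^ 2
      have e1 : y ^ a = (y ^ (a / 2)) ^ 2 := by
        rw [← Real.rpow_natCast, ← Real.rpow_mul h0]; congr 1; push_cast; ring
      have e2 : y ^ b = (y ^ (b / 2)) ^ 2 := by
        rw [← Real.rpow_natCast, ← Real.rpow_mul h0]; congr 1; push_cast; ring
      have e3 : y ^ ((a + b) / 2) = y ^ (a / 2) * y ^ (b / 2) := by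
        rw [← Real.rpow_add_of_nonneg h0 (by positivity) (by positivity)]; congr 1; ring
      rw [e1, e2, e3]
      nlinarith [sq_nonneg (l * y ^ (a / 2) - y ^ (b / 2))]
    rw [intervalIntegral.integral_add (ia.const_mul _) ib, intervalIntegral.integral_const_mul,
      intervalIntegral.integral_const_mul] at this
    have h2 := mul_le_mul_of_nonneg_left this (show 0 ≤ 2 / π by positivity)
    rw [hAd, hBd, hMd]
    unfold arcsineMoment
    linarith
  have h := main (M / A)
  have h2 : 2 * (M / A) * M = 2 * (M ^ 2 / A) := by ring
  have h3 : (M / A) ^ 2 * A = M ^ 2 / A := by field_simp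
  rw [h2, h3] at h
  have h4 : M ^ 2 / A ≤ B := by linarith
  rw [div_le_iff₀ hA] at h4
  linarith

/-! ### The overlap distribution -/

/-- The probability that two independent uniform `h`-subsets of a `2h`-set meet in `k` points. -/
noncomputable def overlapWeight (h k : ℕ) : ℝ := (h.choose k : ℝ) ^ 2 / h.centralBinom

theorem overlapWeight_nonneg (h k : ℕ) : 0 ≤ overlapWeight h k := by
  unfold overlapWeight; positivity

theorem sum_overlapWeight (h : ℕ) : ∑ k ∈ Finset.range (h + 1), overlapWeight h k = 1 := by
  have h0 : (h.centralBinom : ℝ) ≠ 0 := by exact_mod_cast h.centralBinom_ne_zero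
  have := Nat.sum_range_choose_sq h
  unfold overlapWeight
  rw [← Finset.sum_div, div_eq_one_iff_eq h0, Nat.centralBinom]
  exact_mod_cast this

/-- Absorb k and g+1-k into one binomial coefficient each; what remains is a Vandermonde
convolution. -/
theorem sum_mul_sub_mul_choose_sq (g : ℕ) :
    ∑ k ∈ Finset.range (g + 2), (k : ℝ) * ((g + 1 : ℝ) - k) * ((g + 1).choose k : ℝ) ^ 2 =
      (g + 1 : ℝ) ^ 2 * ((2 * g).choose (g + 1) : ℝ) := by
  have h1 : ((2 * g).choose (g + 1) : ℝ) =
      ∑ i ∈ Finset.range (g + 1), (g.choose i : ℝ) * (g.choose (i + 1) : ℝ) := by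
    rw [two_mul, Nat.add_choose_eq, Finset.Nat.sum_antidiagonal_eq_sum_range_succ_mk,
      Finset.sum_range_succ']
    simp only [Nat.sub_zero, Nat.choose_succ_self, mul_zero, add_zero]
    push_cast
    refine Finset.sum_congr rfl fun i hi => ?_
    have hi' : i ≤ g := by simpa [Nat.lt_succ_iff] using hi
    rw [Nat.choose_symm hi', mul_comm]
  rw [Finset.sum_range_succ', h1, Finset.mul_sum]
  simp only [Nat.cast_zero, zero_mul, add_zero]
  refine Finset.sum_congr rfl fun i hi => ?_
  have hi' : i ≤ g := by simpa [Nat.lt_succ_iff] using hi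
  have e1 : ((g + 1 : ℝ)) * g.choose i = (g + 1).choose (i + 1) * (i + 1) := by
    exact_mod_cast Nat.add_one_mul_choose_eq g i
  have e2 : (g.choose (i + 1) : ℝ) * (g + 1) = (g + 1).choose (i + 1) * (g - i) := by
    have := Nat.choose_mul_succ_eq g (i + 1)
    rw [show g + 1 - (i + 1) = g - i by omega] at this
    have h2 := congrArg (Nat.cast (R := ℝ)) this
    push_cast [Nat.cast_sub hi'] at h2
    exact h2
  push_cast
  calc ((i : ℝ) + 1) * ((g + 1 : ℝ) - (i + 1)) * ((g + 1).choose (i + 1) : ℝ) ^ 2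
      = ((g + 1).choose (i + 1) * (i + 1)) * ((g + 1).choose (i + 1) * (g - i)) := by ring
    _ = _ := by rw [← e1, ← e2]; ring

theorem choose_succ_mul_eq (g : ℕ) :
    ((2 * g).choose (g + 1) : ℝ) * (g + 1) = g * g.centralBinom := by
  have := Nat.choose_succ_right_eq (2 * g) g
  rw [show 2 * g - g = g by omega] at this
  have h2 := congrArg (Nat.cast (R := ℝ)) this
  push_cast at h2
  rw [h2, Nat.centralBinom, mul_comm]

/-- The variance of the overlap. -/
theorem sum_overlapWeight_mul_sq {h : ℕ} (hh : 1 ≤ h) :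
    ∑ k ∈ Finset.range (h + 1), overlapWeight h k * ((2 * k - h : ℝ) / h) ^ 2 =
      1 / (2 * h - 1) := by
  obtain ⟨g, rfl⟩ : ∃ g, h = g + 1 := ⟨h - 1, by omega⟩
  have h0 : ((g + 1).centralBinom : ℝ) ≠ 0 := by exact_mod_cast (g + 1).centralBinom_ne_zero
  have hc : ((g : ℝ) + 1) * (g + 1).centralBinom = 2 * (2 * g + 1) * g.centralBinom := by
    exact_mod_cast Nat.succ_mul_centralBinom_succ g
  have e1 := sum_mul_sub_mul_choose_sq g
  have e2 := choose_succ_mul_eq g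
  have e3 := sum_overlapWeight (g + 1)
  have hg : (0 : ℝ) < g + 1 := by positivity
  have hg2 : (0 : ℝ) < 2 * g + 1 := by positivity
  -- Uses ((2k-h)/h)² = 1 - 4k(h-k)/h².
  have key : ∑ k ∈ Finset.range (g + 1 + 1), overlapWeight (g + 1) k *
      ((2 * k - (g + 1 : ℕ) : ℝ) / (g + 1 : ℕ)) ^ 2 =
      ∑ k ∈ Finset.range (g + 1 + 1), overlapWeight (g + 1) k -
      4 / ((g + 1 : ℝ) ^ 2 * (g + 1).centralBinom) *
      ∑ k ∈ Finset.range (g + 2), (k : ℝ) * ((g + 1 : ℝ) - k) * ((g + 1).choose k : ℝ) ^ 2 := by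
    rw [Finset.mul_sum, ← Finset.sum_sub_distrib]
    refine Finset.sum_congr rfl fun k _ => ?_
    unfold overlapWeight
    push_cast
    field_simp
    ring
  rw [key, e3, e1]
  have e4 : ((2 * g).choose (g + 1) : ℝ) = g * g.centralBinom / (g + 1) := by
    rw [← e2]; field_simp
  have e5 : ((g + 1).centralBinom : ℝ) = 2 * (2 * g + 1) * g.centralBinom / (g + 1) := by
    rw [← hc]; field_simp
  have h1 : (g.centralBinom : ℝ) ≠ 0 := by exact_mod_cast g.centralBinom_ne_zero
  rw [e4, e5]
  have : (2 * ((g + 1 : ℕ) : ℝ) - 1) = 2 * g + 1 := by push_cast; ring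
  rw [this]
  field_simp
  ring

/-- Chernoff bound: keep one term of (e^y + e^(-y))^h at tilt y = (2k-h)/h, and use cosh y ≤
exp(y²/2). -/
theorem choose_le_two_pow_mul_exp {h k : ℕ} (hh : 1 ≤ h) (hk : k ≤ h) :
    (h.choose k : ℝ) ≤ 2 ^ h * Real.exp (-(h * ((2 * k - h : ℝ) / h) ^ 2 / 2)) := by
  have hpos : (0 : ℝ) < h := by exact_mod_cast hh
  set y : ℝ := (2 * k - h : ℝ) / h with hy
  have h1 : (Real.exp y) ^ k * (Real.exp (-y)) ^ (h - k) * h.choose k ≤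
      (Real.exp y + Real.exp (-y)) ^ h := by
    rw [add_pow]
    exact Finset.single_le_sum (f := fun m => Real.exp y ^ m * Real.exp (-y) ^ (h - m) *
      (h.choose m : ℝ)) (fun i _ => by positivity) (Finset.mem_range.2 (by omega))
  have h2 : (Real.exp y) ^ k * (Real.exp (-y)) ^ (h - k) = Real.exp (h * y ^ 2) := by
    rw [← Real.exp_nat_mul, ← Real.exp_nat_mul, ← Real.exp_add, Nat.cast_sub hk]
    congr 1
    have : (2 * k - h : ℝ) = h * y := by rw [hy]; field_simp
    linear_combination y * this
  have h3 : (Real.exp y + Real.exp (-y)) ^ h ≤ 2 ^ h * Real.exp (h * y ^ 2 / 2) := by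
    have h4 : Real.exp y + Real.exp (-y) = 2 * Real.cosh y := by rw [Real.cosh_eq]; ring
    rw [h4, mul_pow]
    have h5 : Real.exp (h * y ^ 2 / 2) = Real.exp (y ^ 2 / 2) ^ h := by
      rw [← Real.exp_nat_mul]; ring_nf
    rw [h5]
    gcongr
    exact Real.cosh_le_exp_half_sq y
  rw [h2] at h1
  have h6 : Real.exp (h * y ^ 2 / 2) =
      Real.exp (h * y ^ 2) * Real.exp (-(h * y ^ 2 / 2)) := by
    rw [← Real.exp_add]; ring_nf
  rw [h6] at h3
  have h7 := h1.trans h3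
  have h8 := Real.exp_pos (h * y ^ 2)
  refine le_of_mul_le_mul_left ?_ h8
  linarith

theorem overlapWeight_le {h k : ℕ} (hh : 1 ≤ h) (hk : k ≤ h) :
    overlapWeight h k ≤ 2 * h * Real.exp (-(h * ((2 * k - h : ℝ) / h) ^ 2)) := by
  have hc : (0 : ℝ) < h.centralBinom := by exact_mod_cast h.centralBinom_pos
  have h4 : (4 : ℝ) ^ h ≤ 2 * h * h.centralBinom := by
    exact_mod_cast Nat.four_pow_le_two_mul_self_mul_centralBinom h hh
  have h1 := choose_le_two_pow_mul_exp hh hk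
  set E := Real.exp (-(h * ((2 * k - h : ℝ) / h) ^ 2 / 2)) with hE
  have h2 : Real.exp (-(h * ((2 * k - h : ℝ) / h) ^ 2)) = E ^ 2 := by
    rw [hE, ← Real.exp_nat_mul]; push_cast; ring_nf
  rw [h2, overlapWeight, div_le_iff₀ hc]
  calc (h.choose k : ℝ) ^ 2 ≤ (2 ^ h * E) ^ 2 := by gcongr
    _ = 4 ^ h * E ^ 2 := by rw [mul_pow, ← pow_mul, mul_comm h 2, pow_mul]; norm_num
    _ ≤ 2 * h * h.centralBinom * E ^ 2 := by gcongr
    _ = _ := by ring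

/-! ### Counting sets by their overlap with a fixed set -/

theorem card_filter_card_inter_eq {α : Type*} [Fintype α] [DecidableEq α] {h : ℕ} (U : Finset α)
    (hU : U.card = h) (hα : Fintype.card α = 2 * h) {k : ℕ} (hk : k ≤ h) :
    ((Finset.powersetCard h (Finset.univ : Finset α)).filter fun V => (V ∩ U).card = k).card =
      h.choose k ^ 2 := by
  have hUc : Uᶜ.card = h := by rw [Finset.card_compl, hU, hα]; omega
  have : (Finset.powersetCard k U ×ˢ Finset.powersetCard (h - k) Uᶜ).card = h.choose k ^ 2 := by
    rw [Finset.card_product, Finset.card_powersetCard, Finset.card_powersetCard, hU, hUc,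
      Nat.choose_symm hk, sq]
  rw [← this]
  refine Finset.card_nbij' (fun V => (V ∩ U, V ∩ Uᶜ)) (fun q => q.1 ∪ q.2) ?_ ?_ ?_ ?_
  · intro V hV
    simp only [Finset.coe_filter, Finset.mem_powersetCard, Finset.subset_univ, true_and,
      Set.mem_ofPred_eq] at hV
    have h1 : (V ∩ U).card + (V ∩ Uᶜ).card = V.card := by
      rw [← Finset.sdiff_eq_inter_compl]; exact Finset.card_inter_add_card_sdiff V U
    simp only [Finset.coe_product, Set.mem_prod, Finset.mem_coe, Finset.mem_powersetCard]
    exact ⟨⟨Finset.inter_subset_right, hV.2⟩, Finset.inter_subset_right, by omega⟩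
  · rintro ⟨A, B⟩ hAB
    simp only [Finset.coe_product, Set.mem_prod, Finset.mem_coe, Finset.mem_powersetCard] at hAB
    obtain ⟨⟨hA, hA'⟩, hB, hB'⟩ := hAB
    have hd : Disjoint U B := by
      rw [Finset.disjoint_right]; exact fun x hx => Finset.mem_compl.1 (hB hx)
    have e : (A ∪ B) ∩ U = A := by
      rw [Finset.union_inter_distrib_right, Finset.inter_eq_left.2 hA,
        Finset.inter_comm B, Finset.disjoint_iff_inter_eq_empty.1 hd, Finset.union_empty]
    simp only [Finset.coe_filter, Finset.mem_powersetCard, Finset.subset_univ, true_and,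
      Set.mem_ofPred_eq, e]
    refine ⟨?_, hA'⟩
    rw [Finset.card_union_of_disjoint (hd.mono_left hA)]
    omega
  · intro V _
    simp only [← Finset.inter_union_distrib_left, Finset.union_compl, Finset.inter_univ]
  · rintro ⟨A, B⟩ hAB
    simp only [Finset.coe_product, Set.mem_prod, Finset.mem_coe, Finset.mem_powersetCard] at hAB
    obtain ⟨⟨hA, -⟩, hB, -⟩ := hAB
    have hd : Disjoint U B := by
      rw [Finset.disjoint_right]; exact fun x hx => Finset.mem_compl.1 (hB hx)
    have hd' : Disjoint A Uᶜ := by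
      rw [Finset.disjoint_left]; exact fun x hx h => Finset.mem_compl.1 h (hA hx)
    simp only [Prod.mk.injEq]
    constructor
    · rw [Finset.union_inter_distrib_right, Finset.inter_eq_left.2 hA,
        Finset.inter_comm B, Finset.disjoint_iff_inter_eq_empty.1 hd, Finset.union_empty]
    · rw [Finset.union_inter_distrib_right, Finset.inter_eq_left.2 hB,
        Finset.disjoint_iff_inter_eq_empty.1 hd', Finset.empty_union]

theorem sum_powersetCard_card_inter {α : Type*} [Fintype α] [DecidableEq α] {h : ℕ}
    (U : Finset α) (hU : U.card = h) (hα : Fintype.card α = 2 * h) (F : ℕ → ℝ) :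
    ∑ V ∈ Finset.powersetCard h (Finset.univ : Finset α), F (V ∩ U).card =
      ∑ k ∈ Finset.range (h + 1), (h.choose k : ℝ) ^ 2 * F k := by
  rw [← Finset.sum_fiberwise_of_maps_to (g := fun V => (V ∩ U).card) (t := Finset.range (h + 1))]
  · refine Finset.sum_congr rfl fun k hk => ?_
    have hk' : k ≤ h := by simpa [Nat.lt_succ_iff] using hk
    rw [Finset.sum_congr rfl (g := fun _ => F k), Finset.sum_const,
      card_filter_card_inter_eq U hU hα hk', nsmul_eq_mul]
    · push_cast; ring
    · intro V hV
      rw [(Finset.mem_filter.1 hV).2]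
  · intro V _
    have := Finset.card_le_card (Finset.inter_subset_right : V ∩ U ⊆ U)
    simp only [Finset.mem_range]; omega

/-! ### Fourier inversion on a half period -/

/-- The uniform law on `(-π/2, π/2]`. -/
noncomputable def phaseLaw : Measure ℝ :=
  ENNReal.ofReal (1 / π) • volume.restrict (Set.Ioc (-(π / 2)) (π / 2))

instance : IsProbabilityMeasure phaseLaw := by
  constructor
  have hpi := Real.pi_pos
  rw [phaseLaw, Measure.smul_apply, Measure.restrict_apply_univ, Real.volume_Ioc, smul_eq_mul,
    ← ENNReal.ofReal_mul (by positivity)]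
  rw [show 1 / π * (π / 2 - -(π / 2)) = 1 by field_simp; norm_num, ENNReal.ofReal_one]

theorem integral_phaseLaw (g : ℝ → ℂ) :
    ∫ φ, g φ ∂phaseLaw = (1 / π : ℝ) * ∫ φ in (-(π / 2))..(π / 2), g φ := by
  have hpi := Real.pi_pos
  rw [phaseLaw, integral_smul_measure, intervalIntegral.integral_of_le (by linarith),
    ENNReal.toReal_ofReal (by positivity), Complex.real_smul]

theorem integral_phaseLaw_exp (z : ℤ) :
    ∫ φ : ℝ, Complex.exp (2 * φ * z * Complex.I) ∂phaseLaw = if z = 0 then 1 else 0 := by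
  have hpi := Real.pi_pos
  split_ifs with hz
  · simp [hz]
  · rw [integral_phaseLaw]
    have hc : (2 * z * Complex.I : ℂ) ≠ 0 := by simp [hz]
    have h1 : (fun φ : ℝ => Complex.exp (2 * φ * z * Complex.I)) =
        fun φ : ℝ => Complex.exp (2 * z * Complex.I * φ) := by
      funext φ; ring_nf
    rw [h1, integral_exp_mul_complex hc]
    have h2 : Complex.exp (2 * z * Complex.I * ((π / 2 : ℝ) : ℂ)) =
        Complex.exp (2 * z * Complex.I * ((-(π / 2) : ℝ) : ℂ)) := by
      rw [Complex.exp_eq_exp_iff_exists_int]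
      refine ⟨z, ?_⟩
      push_cast; ring
    rw [h2]; simp

/-- The product is |1-p+p e^(2iφ)|² = 1 - 4p(1-p) sin² φ, which is where s = 2p(1-p) comes from. -/
theorem integral_phaseLaw_pow (p : ℝ) (k : ℕ) :
    ∫ φ : ℝ, ((1 - p + p * Complex.exp (2 * φ * (1 : ℤ) * Complex.I)) *
      (1 - p + p * Complex.exp (2 * φ * (-1 : ℤ) * Complex.I))) ^ k ∂phaseLaw =
      (arcsineMoment (2 * p * (1 - p)) k : ℂ) := by
  have hpi := Real.pi_pos
  have h1 : ∀ φ : ℝ, ((1 - p + p * Complex.exp (2 * φ * (1 : ℤ) * Complex.I)) *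
      (1 - p + p * Complex.exp (2 * φ * (-1 : ℤ) * Complex.I)) : ℂ) =
      ((1 - 2 * (2 * p * (1 - p)) * Real.sin φ ^ 2 : ℝ) : ℂ) := by
    intro φ
    have e1 : (2 * φ * (1 : ℤ) * Complex.I : ℂ) = ((2 * φ : ℝ) : ℂ) * Complex.I := by
      push_cast; ring
    have e2 : (2 * φ * (-1 : ℤ) * Complex.I : ℂ) = ((-(2 * φ) : ℝ) : ℂ) * Complex.I := by
      push_cast; ring
    rw [e1, e2, Complex.exp_mul_I, Complex.exp_mul_I, ← Complex.ofReal_cos, ← Complex.ofReal_cos,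
      ← Complex.ofReal_sin, ← Complex.ofReal_sin, Real.cos_neg, Real.sin_neg, Real.cos_two_mul,
      Real.sin_two_mul]
    have hs := Real.sin_sq_add_cos_sq φ
    apply Complex.ext
    · simp [pow_two, -Complex.ofReal_cos, -Complex.ofReal_sin]
      have hc2 : Real.cos φ ^ 2 = 1 - Real.sin φ ^ 2 := by linarith
      ring_nf
      rw [show Real.cos φ ^ 4 = (Real.cos φ ^ 2) ^ 2 by ring, hc2]
      ring
    · simp [pow_two, -Complex.ofReal_cos, -Complex.ofReal_sin]
      ring
  simp_rw [h1]
  rw [integral_phaseLaw]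
  simp_rw [← Complex.ofReal_pow]
  rw [intervalIntegral.integral_ofReal, ← Complex.ofReal_mul]
  congr 1
  unfold arcsineMoment
  simp_rw [Real.rpow_natCast]
  have hcont : Continuous fun φ : ℝ => (1 - 2 * (2 * p * (1 - p)) * Real.sin φ ^ 2) ^ k := by
    fun_prop
  rw [← intervalIntegral.integral_add_adjacent_intervals
    (hcont.intervalIntegrable (-(π / 2)) 0) (hcont.intervalIntegrable 0 (π / 2))]
  have h3 := intervalIntegral.integral_comp_neg (a := 0) (b := π / 2)
    (f := fun φ : ℝ => (1 - 2 * (2 * p * (1 - p)) * Real.sin φ ^ 2) ^ k)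
  simp only [Real.sin_neg, neg_sq, neg_zero] at h3
  rw [← h3]
  ring

/-! ### The law of one row -/

/-- The law of one row of the Bernoulli ensemble. -/
noncomputable def rowLaw (n : ℕ) (p : unitInterval) : Measure (Fin n → ℤ) :=
  Measure.pi fun _ => bernoulliMeasure (1 : ℤ) 0 p

instance (n : ℕ) (p : unitInterval) : IsProbabilityMeasure (rowLaw n p) := by
  unfold rowLaw; infer_instance

/-- Each constraint is detected by its own phase; after Fubini, independence of the entries gives
the product. -/
theorem rowLaw_real_orthogonal {n : ℕ} (p : unitInterval) (α β : Fin n → ℤ) :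
    ((rowLaw n p).real {a | ∑ i, a i * α i = 0 ∧ ∑ i, a i * β i = 0} : ℂ) =
      ∫ z : ℝ × ℝ, ∏ i, (1 - (p : ℝ) + (p : ℝ) * (Complex.exp (2 * z.1 * α i * Complex.I) *
        Complex.exp (2 * z.2 * β i * Complex.I))) ∂(phaseLaw.prod phaseLaw) := by
  set F : (Fin n → ℤ) → ℝ × ℝ → ℂ := fun a z =>
    Complex.exp (2 * z.1 * (∑ i, a i * α i : ℤ) * Complex.I) *
      Complex.exp (2 * z.2 * (∑ i, a i * β i : ℤ) * Complex.I) with hF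
  have h1 : ∀ a, ∫ z, F a z ∂(phaseLaw.prod phaseLaw) =
      Set.indicator {a : Fin n → ℤ | ∑ i, a i * α i = 0 ∧ ∑ i, a i * β i = 0}
        (fun _ => (1 : ℂ)) a := by
    intro a
    rw [hF, integral_prod_mul (μ := phaseLaw) (ν := phaseLaw)
      (fun φ : ℝ => Complex.exp (2 * φ * (∑ i, a i * α i : ℤ) * Complex.I))
      (fun φ : ℝ => Complex.exp (2 * φ * (∑ i, a i * β i : ℤ) * Complex.I)),
      integral_phaseLaw_exp, integral_phaseLaw_exp, Set.indicator_apply]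
    by_cases hα : ∑ i, a i * α i = 0 <;> by_cases hβ : ∑ i, a i * β i = 0 <;> simp [hα, hβ]
  have h2 : ∀ z, ∫ a, F a z ∂(rowLaw n p) =
      ∏ i, (1 - (p : ℝ) + (p : ℝ) * (Complex.exp (2 * z.1 * α i * Complex.I) *
        Complex.exp (2 * z.2 * β i * Complex.I)) : ℂ) := by
    intro z
    have e1 : ∀ a, F a z = ∏ i, Complex.exp ((2 * z.1 * α i * Complex.I +
        2 * z.2 * β i * Complex.I) * a i) := by
      intro a
      rw [hF, ← Complex.exp_sum]
      simp only
      rw [← Complex.exp_add]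
      congr 1
      push_cast
      simp only [Finset.mul_sum, Finset.sum_mul]
      rw [← Finset.sum_add_distrib]
      exact Finset.sum_congr rfl fun i _ => by ring
    simp_rw [e1]
    rw [rowLaw, integral_fintype_prod_eq_prod (fun i (x : ℤ) =>
      Complex.exp ((2 * z.1 * α i * Complex.I + 2 * z.2 * β i * Complex.I) * x))]
    refine Finset.prod_congr rfl fun i _ => ?_
    rw [integral_bernoulliMeasure]
    simp [← Complex.exp_add, add_comm]
  have hint : Integrable (Function.uncurry F) ((rowLaw n p).prod (phaseLaw.prod phaseLaw)) := by
    refine Integrable.of_bound (C := 1) ?_ (Eventually.of_forall ?_)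
    · refine (Measurable.aestronglyMeasurable ?_)
      refine measurable_from_prod_countable_right fun a => ?_
      refine Continuous.measurable ?_
      simp only [hF, Function.uncurry]
      fun_prop
    · rintro ⟨a, z⟩
      simp only [hF, Function.uncurry, norm_mul]
      have e : ∀ (x : ℝ) (y : ℤ), ‖Complex.exp (2 * x * y * Complex.I)‖ = 1 := by
        intro x y
        have := Complex.norm_exp_ofReal_mul_I (2 * x * y)
        push_cast at this
        exact this
      rw [e, e]; norm_num
  have hS : MeasurableSet {a : Fin n → ℤ | ∑ i, a i * α i = 0 ∧ ∑ i, a i * β i = 0} :=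
    MeasurableSet.of_discrete
  simp_rw [← h2]
  rw [← integral_integral_swap hint]
  simp_rw [h1]
  rw [integral_indicator_const _ hS]
  simp

/-- The `±1` vector which is `1` exactly on `U`. -/
def signVector {n : ℕ} (U : Finset (Fin n)) : Fin n → ℤ := fun i => if i ∈ U then 1 else -1

/-- With u, v the two sign vectors, α = (u+v)/2 and β = (u-v)/2 span the same constraints but have
disjoint supports, so the two phases separate. α has k entries of each sign and β has h-k. -/
theorem rowLaw_real_signVector {h n : ℕ} (hn : n = 2 * h) (p : unitInterval) (U V : Finset (Fin n))
    (hU : U.card = h) (hV : V.card = h) :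
    (rowLaw n p).real {a | ∑ i, a i * signVector U i = 0 ∧ ∑ i, a i * signVector V i = 0} =
      arcsineMoment (2 * p * (1 - p)) ((V ∩ U).card : ℕ) *
        arcsineMoment (2 * p * (1 - p)) ((h - (V ∩ U).card : ℕ) : ℕ) := by
  set α : Fin n → ℤ := fun i => if i ∈ U then (if i ∈ V then 1 else 0)
    else (if i ∈ V then 0 else -1) with hα
  set β : Fin n → ℤ := fun i => if i ∈ U then (if i ∈ V then 0 else 1)
    else (if i ∈ V then -1 else 0) with hβ
  have hset : {a : Fin n → ℤ | ∑ i, a i * signVector U i = 0 ∧ ∑ i, a i * signVector V i = 0} =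
      {a | ∑ i, a i * α i = 0 ∧ ∑ i, a i * β i = 0} := by
    ext a
    have e1 : ∑ i, a i * signVector U i = ∑ i, a i * α i + ∑ i, a i * β i := by
      rw [← Finset.sum_add_distrib]
      refine Finset.sum_congr rfl fun i _ => ?_
      simp only [signVector, hα, hβ]
      split_ifs <;> ring
    have e2 : ∑ i, a i * signVector V i = ∑ i, a i * α i - ∑ i, a i * β i := by
      rw [← Finset.sum_sub_distrib]
      refine Finset.sum_congr rfl fun i _ => ?_
      simp only [signVector, hα, hβ]
      split_ifs <;> ring
    simp only [Set.mem_ofPred_eq, e1, e2]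
    omega
  set k := (V ∩ U).card with hk
  have c1 : (U.filter (· ∈ V)).card = k := by
    rw [Finset.filter_mem_eq_inter, Finset.inter_comm]
  have c2 : (U.filter (¬ · ∈ V)).card = h - k := by
    have := Finset.card_filter_add_card_filter_not (s := U) (· ∈ V)
    omega
  have c3 : (Uᶜ.filter (· ∈ V)).card = h - k := by
    have h1 : Uᶜ.filter (· ∈ V) = V \ U := by ext i; simp [and_comm]
    rw [h1]
    have := Finset.card_inter_add_card_sdiff V U
    omega
  have c4 : (Uᶜ.filter (¬ · ∈ V)).card = k := by
    have := Finset.card_filter_add_card_filter_not (s := Uᶜ) (· ∈ V)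
    have h1 : Uᶜ.card = h := by rw [Finset.card_compl, hU, Fintype.card_fin]; omega
    have h2 : k ≤ h := hV ▸ Finset.card_le_card Finset.inter_subset_left
    omega
  set A : ℤ → ℝ → ℂ := fun z φ => 1 - (p : ℝ) + (p : ℝ) * Complex.exp (2 * φ * z * Complex.I)
    with hA
  have hprod : ∀ z : ℝ × ℝ, ∏ i, (1 - (p : ℝ) + (p : ℝ) *
      (Complex.exp (2 * z.1 * α i * Complex.I) * Complex.exp (2 * z.2 * β i * Complex.I)) : ℂ) =
      (A 1 z.1 * A (-1) z.1) ^ k * (A 1 z.2 * A (-1) z.2) ^ (h - k) := by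
    intro z
    have e1 : ∀ i, (1 - (p : ℝ) + (p : ℝ) *
      (Complex.exp (2 * z.1 * α i * Complex.I) * Complex.exp (2 * z.2 * β i * Complex.I)) : ℂ) =
      if i ∈ U then (if i ∈ V then A 1 z.1 else A 1 z.2)
        else (if i ∈ V then A (-1) z.2 else A (-1) z.1) := by
      intro i
      simp only [hα, hβ, hA]
      split_ifs <;> simp
    simp_rw [e1]
    rw [← Finset.prod_mul_prod_compl U]
    have e2 : ∏ i ∈ U, (if i ∈ U then (if i ∈ V then A 1 z.1 else A 1 z.2)
        else (if i ∈ V then A (-1) z.2 else A (-1) z.1)) =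
        ∏ i ∈ U, (if i ∈ V then A 1 z.1 else A 1 z.2) :=
      Finset.prod_congr rfl fun i hi => by rw [if_pos hi]
    have e3 : ∏ i ∈ Uᶜ, (if i ∈ U then (if i ∈ V then A 1 z.1 else A 1 z.2)
        else (if i ∈ V then A (-1) z.2 else A (-1) z.1)) =
        ∏ i ∈ Uᶜ, (if i ∈ V then A (-1) z.2 else A (-1) z.1) :=
      Finset.prod_congr rfl fun i hi => by rw [if_neg (Finset.mem_compl.1 hi)]
    rw [e2, e3, Finset.prod_ite, Finset.prod_ite, Finset.prod_const, Finset.prod_const,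
      Finset.prod_const, Finset.prod_const, c1, c2, c3, c4]
    rw [mul_pow, mul_pow]
    ac_rfl
  rw [hset]
  have hfin : ((rowLaw n p).real {a | ∑ i, a i * α i = 0 ∧ ∑ i, a i * β i = 0} : ℂ) =
      (arcsineMoment (2 * p * (1 - p)) (k : ℕ) : ℂ) *
        (arcsineMoment (2 * p * (1 - p)) ((h - k : ℕ) : ℕ) : ℂ) := by
    rw [rowLaw_real_orthogonal]
    simp_rw [hprod]
    rw [integral_prod_mul (μ := phaseLaw) (ν := phaseLaw) (fun φ => (A 1 φ * A (-1) φ) ^ k)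
      (fun φ => (A 1 φ * A (-1) φ) ^ (h - k))]
    rw [hA, integral_phaseLaw_pow, integral_phaseLaw_pow]
  exact_mod_cast hfin

/-- The expectation of (-1)^(row sum) factors into (1-2p)^n. -/
theorem rowLaw_real_even (n : ℕ) (p : unitInterval) :
    (rowLaw n p).real {a | Even (∑ j, a j)} = (1 + (1 - 2 * (p : ℝ)) ^ n) / 2 := by
  have hS : MeasurableSet {a : Fin n → ℤ | Even (∑ j, a j)} := MeasurableSet.of_discrete
  have h1 : ∀ a : Fin n → ℤ, ∏ j, (-1 : ℝ) ^ (a j) =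
      2 * Set.indicator {a : Fin n → ℤ | Even (∑ j, a j)} (fun _ => (1 : ℝ)) a - 1 := by
    intro a
    have e : ∀ s : Finset (Fin n), ∏ j ∈ s, (-1 : ℝ) ^ (a j) = (-1 : ℝ) ^ (∑ j ∈ s, a j) := by
      intro s
      induction s using Finset.induction_on with
      | empty => simp
      | insert i s hi ih => rw [Finset.prod_insert hi, Finset.sum_insert hi, ih,
          zpow_add₀ (by norm_num)]
    rw [e, Set.indicator_apply]
    by_cases hev : Even (∑ j, a j)
    · simp [hev, hev.neg_one_zpow]; norm_num
    · simp [hev, (Int.not_even_iff_odd.1 hev).neg_one_zpow]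
  have h2 : ∫ a : Fin n → ℤ, ∏ j, (-1 : ℝ) ^ (a j) ∂(rowLaw n p) = (1 - 2 * (p : ℝ)) ^ n := by
    rw [rowLaw, integral_fintype_prod_eq_prod (fun _ (x : ℤ) => (-1 : ℝ) ^ x)]
    simp only [integral_bernoulliMeasure]
    rw [Finset.prod_const, Finset.card_univ, Fintype.card_fin]
    congr 1
    simp
    ring
  simp_rw [h1] at h2
  rw [integral_sub ((integrable_const (1 : ℝ)).indicator hS |>.const_mul 2) (integrable_const _),
    integral_const_mul, integral_indicator_const _ hS] at h2
  simp at h2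
  linarith

/-! ### The second moment ratio as an overlap sum -/

theorem sum_balanced {h n : ℕ} (hn : n = 2 * h) {M : Type*} [AddCommMonoid M]
    (F : (Fin n → ℤ) → M) :
    ∑ u ∈ balanced n, F u = ∑ U ∈ Finset.powersetCard h Finset.univ, F (signVector U) := by
  have hsum : ∀ U : Finset (Fin n), ∑ i, signVector U i = 2 * (U.card : ℤ) - n := by
    intro U
    have : ∀ i, signVector U i = 2 * (if i ∈ U then 1 else 0) - 1 := by
      intro i; unfold signVector; split_ifs <;> norm_num
    simp only [this, Finset.sum_sub_distrib, ← Finset.mul_sum]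
    simp
  refine (Finset.sum_nbij' (fun U => signVector U) (fun u => Finset.univ.filter fun i => u i = 1)
    ?_ ?_ ?_ ?_ ?_).symm
  · intro U hU
    rw [Finset.mem_powersetCard] at hU
    simp only [balanced, Finset.mem_filter, Fintype.mem_piFinset, hsum]
    refine ⟨fun i => ?_, by rw [hU.2, hn]; push_cast; ring⟩
    unfold signVector; split_ifs <;> simp
  · intro u hu
    simp only [balanced, Finset.mem_filter, Fintype.mem_piFinset] at hu
    have h1 : signVector (Finset.univ.filter fun i => u i = 1) = u := by
      funext i
      have := hu.1 i
      simp only [Finset.mem_insert, Finset.mem_singleton] at this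
      unfold signVector
      rcases this with h | h <;> simp [h]
    have h2 := hsum (Finset.univ.filter fun i => u i = 1)
    rw [h1, hu.2] at h2
    rw [Finset.mem_powersetCard]
    refine ⟨Finset.subset_univ _, ?_⟩
    omega
  · intro U _
    ext i
    by_cases hi : i ∈ U <;> simp [signVector, hi]
  · intro u hu
    simp only [balanced, Finset.mem_filter, Fintype.mem_piFinset] at hu
    funext i
    have := hu.1 i
    simp only [Finset.mem_insert, Finset.mem_singleton] at this
    unfold signVector
    rcases this with h | h <;> simp [h]
  · intro U _; rfl

instance (m n : ℕ) (p : unitInterval) : IsProbabilityMeasure (bernoulliEnsemble m n p) := by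
  unfold bernoulliEnsemble; infer_instance

theorem bernoulliEnsemble_real_forall_row (m n : ℕ) (p : unitInterval) (S : Set (Fin n → ℤ)) :
    (bernoulliEnsemble m n p).real {A | ∀ i, A i ∈ S} = (rowLaw n p).real S ^ m := by
  have h1 : {A : Fin m → Fin n → ℤ | ∀ i, A i ∈ S} = Set.univ.pi fun _ => S := by
    ext A; simp
  have h2 : bernoulliEnsemble m n p = Measure.pi fun _ : Fin m => rowLaw n p := rfl
  rw [h1, h2, measureReal_def, Measure.pi_pi, Finset.prod_const, Finset.card_univ,
    Fintype.card_fin, ENNReal.toReal_pow, measureReal_def]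

/-- The matrices that annihilate `u`. -/
def annihilators (m : ℕ) {n : ℕ} (u : Fin n → ℤ) : Set (Fin m → Fin n → ℤ) :=
  {A | ∀ i, ∑ j, A i j * u j = 0}

/-- Signs are invisible modulo 2. Hence conditioning on even rows merely divides the probability of
annihilation by that of the event. -/
theorem annihilators_subset_evenRows (m : ℕ) {n : ℕ} (U : Finset (Fin n)) :
    annihilators m (signVector U) ⊆ evenRows m n := by
  intro A hA i
  have h1 := hA i
  have h2 : ∑ j, A i j = ∑ j, A i j * signVector U j + 2 * ∑ j, (if j ∈ U then 0 else A i j) := by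
    rw [Finset.mul_sum, ← Finset.sum_add_distrib]
    refine Finset.sum_congr rfl fun j _ => ?_
    unfold signVector; split_ifs <;> ring
  rw [h2, h1, zero_add]
  exact even_two_mul _

open Classical in
theorem Z_zero_eq_sum {m n : ℕ} (A : Fin m → Fin n → ℤ) :
    (Z 0 A : ℝ) = ∑ u ∈ balanced n, (annihilators m u).indicator (fun _ => (1 : ℝ)) A := by
  have h1 : {u : Fin n → ℤ | u ∈ balanced n ∧ ‖(Matrix.of A).mulVec u‖ ≤ 0} =
      ((balanced n).filter fun u => A ∈ annihilators m u : Finset (Fin n → ℤ)) := by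
    ext u
    simp only [Set.mem_ofPred_eq, Finset.coe_filter, norm_le_zero_iff, funext_iff]
    rfl
  unfold Z
  rw [h1, Set.ncard_coe_finset]
  simp only [Set.indicator_apply]
  rw [Finset.sum_boole]

theorem expGivenEven_sum_indicator {m n : ℕ} (p : unitInterval) {ι : Type*} (s : Finset ι)
    (S : ι → Set (Fin m → Fin n → ℤ)) (hS : ∀ i ∈ s, S i ⊆ evenRows m n) :
    expGivenEven m n p (fun A => ∑ i ∈ s, (S i).indicator (fun _ => (1 : ℝ)) A) =
      ((bernoulliEnsemble m n p).real (evenRows m n))⁻¹ *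
        ∑ i ∈ s, (bernoulliEnsemble m n p).real (S i) := by
  have hms : ∀ T : Set (Fin m → Fin n → ℤ), MeasurableSet T := fun T => MeasurableSet.of_discrete
  unfold expGivenEven
  rw [ProbabilityTheory.cond, integral_smul_measure, ENNReal.toReal_inv, smul_eq_mul,
    integral_finsetSum _ fun i _ => (integrable_const (1 : ℝ)).indicator (hms _),
    measureReal_def]
  congr 1
  refine Finset.sum_congr rfl fun i hi => ?_
  rw [integral_indicator_const _ (hms _), measureReal_restrict_apply (hms _),
    Set.inter_eq_left.2 (hS i hi), smul_eq_mul, mul_one]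

theorem bernoulliEnsemble_real_annihilators {h n : ℕ} (hn : n = 2 * h) (m : ℕ) (p : unitInterval)
    {U V : Finset (Fin n)} (hU : U.card = h) (hV : V.card = h) :
    (bernoulliEnsemble m n p).real
        (annihilators m (signVector U) ∩ annihilators m (signVector V)) =
      (arcsineMoment (2 * p * (1 - p)) ((V ∩ U).card : ℕ) *
        arcsineMoment (2 * p * (1 - p)) ((h - (V ∩ U).card : ℕ) : ℕ)) ^ m := by
  rw [← rowLaw_real_signVector hn p U V hU hV, ← bernoulliEnsemble_real_forall_row]
  congr 1
  ext A
  simp only [annihilators, Set.mem_inter_iff, Set.mem_ofPred_eq, forall_and]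

/-- The probability that a row has an even sum. -/
noncomputable def evenProb (n : ℕ) (p : ℝ) : ℝ := (1 + (1 - 2 * p) ^ n) / 2

theorem arcsineMoment_zero (s : ℝ) : arcsineMoment s 0 = 1 := by
  have := Real.pi_pos
  unfold arcsineMoment
  simp

/-- By symmetry the sum over V does not depend on U. One power of the normalisation survives in the
quotient, giving the factor `evenProb n p` in each base. -/
theorem secondMomentRatio_eq {h n : ℕ} (hn : n = 2 * h) (m : ℕ) (p : unitInterval)
    (he : 0 < evenProb n p) (hp : (2 : ℝ) * p * (1 - p) ≤ 1 / 2) :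
    secondMomentRatio m n p = ∑ k ∈ Finset.range (h + 1), overlapWeight h k *
      (evenProb n p * (arcsineMoment (2 * p * (1 - p)) (k : ℕ) *
        arcsineMoment (2 * p * (1 - p)) ((h - k : ℕ) : ℕ)) /
          arcsineMoment (2 * p * (1 - p)) (h : ℕ) ^ 2) ^ m := by
  set s : ℝ := 2 * p * (1 - p) with hs
  have hP : (bernoulliEnsemble m n p).real (evenRows m n) = evenProb n p ^ m := by
    rw [evenProb, ← rowLaw_real_even, ← bernoulliEnsemble_real_forall_row]
    rfl
  have hcard : (Finset.powersetCard h (Finset.univ : Finset (Fin n))).card = h.centralBinom := by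
    rw [Finset.card_powersetCard, Finset.card_univ, Fintype.card_fin, hn, Nat.centralBinom]
  have hfirst : expGivenEven m n p (fun A => (Z 0 A : ℝ)) =
      (evenProb n p ^ m)⁻¹ * (h.centralBinom * arcsineMoment s (h : ℕ) ^ m) := by
    simp_rw [Z_zero_eq_sum, sum_balanced hn]
    rw [expGivenEven_sum_indicator p _ _ fun U _ => annihilators_subset_evenRows m U, hP]
    congr 1
    rw [← hcard, ← nsmul_eq_mul]
    refine Finset.sum_eq_card_nsmul fun U hU => ?_
    have hU' := (Finset.mem_powersetCard.1 hU).2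
    -- The first moment is the diagonal case V = U, with overlap h and f(0) = 1.
    have := bernoulliEnsemble_real_annihilators hn m p hU' hU'
    rw [Set.inter_self, Finset.inter_self, hU', Nat.sub_self, Nat.cast_zero, ← hs,
      arcsineMoment_zero, mul_one] at this
    exact this
  have hsecond : expGivenEven m n p (fun A => (Z 0 A : ℝ) ^ 2) =
      (evenProb n p ^ m)⁻¹ * (h.centralBinom * ∑ k ∈ Finset.range (h + 1), (h.choose k : ℝ) ^ 2 *
        (arcsineMoment s (k : ℕ) * arcsineMoment s ((h - k : ℕ) : ℕ)) ^ m) := by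
    have e1 : ∀ A : Fin m → Fin n → ℤ, (Z 0 A : ℝ) ^ 2 =
        ∑ q ∈ Finset.powersetCard h (Finset.univ : Finset (Fin n)) ×ˢ
          Finset.powersetCard h (Finset.univ : Finset (Fin n)),
          (annihilators m (signVector q.1) ∩ annihilators m (signVector q.2)).indicator
            (fun _ => (1 : ℝ)) A := by
      intro A
      rw [Z_zero_eq_sum, sum_balanced hn, sq, Finset.sum_mul_sum, Finset.sum_product]
      refine Finset.sum_congr rfl fun U _ => Finset.sum_congr rfl fun V _ => ?_
      have := (Set.inter_indicator_mul (s := annihilators m (signVector U))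
        (t := annihilators m (signVector V)) (fun _ => (1 : ℝ)) (fun _ => (1 : ℝ))) A
      simp only [mul_one] at this
      exact this.symm
    simp_rw [e1]
    rw [expGivenEven_sum_indicator p _ _ fun q _ =>
      Set.inter_subset_left.trans (annihilators_subset_evenRows m q.1), hP]
    congr 1
    rw [Finset.sum_product, ← hcard, ← nsmul_eq_mul]
    refine Finset.sum_eq_card_nsmul fun U hU => ?_
    have hU' := (Finset.mem_powersetCard.1 hU).2
    rw [← sum_powersetCard_card_inter U hU' (by rw [Fintype.card_fin, hn]) fun k =>
      (arcsineMoment s (k : ℕ) * arcsineMoment s ((h - k : ℕ) : ℕ)) ^ m]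
    refine Finset.sum_congr rfl fun V hV => ?_
    exact bernoulliEnsemble_real_annihilators hn m p hU' (Finset.mem_powersetCard.1 hV).2
  have hc : (h.centralBinom : ℝ) ≠ 0 := by exact_mod_cast h.centralBinom_ne_zero
  have hf : arcsineMoment s (h : ℕ) ≠ 0 := (arcsineMoment_pos hp (by positivity)).ne'
  rw [secondMomentRatio, hfirst, hsecond]
  rw [Finset.mul_sum, Finset.mul_sum, Finset.sum_div]
  refine Finset.sum_congr rfl fun k _ => ?_
  have he' := he.ne'
  rw [overlapWeight, div_pow, mul_pow _ (_ * _) m, ← pow_mul, mul_comm 2 m, pow_mul]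
  field_simp

/-! ### Comparing moments at `h / 2` and `h` -/

theorem inv_sqrt_sq {x : ℝ} (hx : 0 < x) : (1 / √x) ^ 2 = 1 / x := by
  rw [div_pow, one_pow, Real.sq_sqrt hx.le]

/-- Halving h doubles the squared leading term, hence the 2; `hle` compares the correction factors
of the lower expansion at h/2 and the upper one at h. -/
theorem two_mul_sq_le_arcsineMoment_half_sq {s h c : ℝ} (hs : 0 < s) (hs' : s ≤ 1 / 2) (hh : 2 ≤ h)
    (hc : 0 ≤ c)
    (hle : c * (1 + 1 / (4 * (2 * s * h)) + 8 / (2 * s * h) ^ 2) ≤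
      1 + (1 / 2 - 3 * s) / (2 * s * h) - 12 / (2 * s * h) ^ 2 - 8 / (2 * s * h) ^ 3) :
    c ^ 2 * (2 * arcsineMoment s h ^ 2) ≤ arcsineMoment s (h / 2) ^ 2 := by
  have hpi := Real.pi_pos
  have h1 := arcsineMoment_le hs hs' (t := h) (by linarith)
  have h2 := le_arcsineMoment hs hs' (t := h / 2) (by linarith)
  have h0 := arcsineMoment_nonneg hs' h
  set T := 2 * s * h with hT
  have hTpos : 0 < T := by positivity
  have hT2 : 2 * s * (h / 2) = T / 2 := by rw [hT]; ring
  rw [hT2] at h2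
  set b := 1 + 1 / (4 * T) + 8 / T ^ 2 with hb
  have hbpos : 0 < b := by positivity
  have ha : 1 + (1 / 4 - 3 / 2 * s) / (T / 2) - 3 / (T / 2) ^ 2 - 1 / (T / 2) ^ 3 =
      1 + (1 / 2 - 3 * s) / T - 12 / T ^ 2 - 8 / T ^ 3 := by
    field_simp; ring
  rw [ha] at h2
  set a := 1 + (1 / 2 - 3 * s) / T - 12 / T ^ 2 - 8 / T ^ 3 with had
  have hapos : 0 ≤ a := (by positivity : 0 ≤ c * b).trans hle
  calc c ^ 2 * (2 * arcsineMoment s h ^ 2) ≤ c ^ 2 * (2 * (1 / √(π * T) * b) ^ 2) := by gcongr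
    _ = (c * b) ^ 2 * (2 * (1 / √(π * T)) ^ 2) := by ring
    _ ≤ a ^ 2 * (2 * (1 / √(π * T)) ^ 2) := by gcongr
    _ = (1 / √(π * (T / 2)) * a) ^ 2 := by
        rw [mul_pow, inv_sqrt_sq (by positivity), inv_sqrt_sq (by positivity)]
        field_simp
    _ ≤ _ := by gcongr

/-- The 1/T coefficients are at least 0.47 at h/2 against 1/4 at h; the surplus covers the gain 1/10
and, for T ≥ 250, the higher-order errors. -/
theorem arcsineMoment_half_sq_ge_sparse {s h : ℝ} (hs : 0 < s) (hs' : s ≤ 1 / 100) (hh : 2 ≤ h)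
    (hT : 250 ≤ 2 * s * h) :
    (1 + 1 / (10 * (2 * s * h))) ^ 2 * (2 * arcsineMoment s h ^ 2) ≤
      arcsineMoment s (h / 2) ^ 2 := by
  refine two_mul_sq_le_arcsineMoment_half_sq hs (by linarith) hh (by positivity) ?_
  set T := 2 * s * h
  have hTpos : 0 < T := by linarith
  set x := 1 / T with hx
  have hx0 : 0 < x := by positivity
  have hx1 : x ≤ 1 / 250 := one_div_le_one_div_of_le (by norm_num) hT
  have e1 : (1 + 1 / (10 * T)) * (1 + 1 / (4 * T) + 8 / T ^ 2) =
      (1 + x / 10) * (1 + x / 4 + 8 * x ^ 2) := by rw [hx]; field_simp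
  have e2 : 1 + (1 / 2 - 3 * s) / T - 12 / T ^ 2 - 8 / T ^ 3 =
      1 + (1 / 2 - 3 * s) * x - 12 * x ^ 2 - 8 * x ^ 3 := by rw [hx]; field_simp
  rw [e1, e2]
  have h1 : (0.47 : ℝ) * x ≤ (1 / 2 - 3 * s) * x := by gcongr; linarith
  have h2 : x ^ 2 ≤ x / 250 := by nlinarith
  have h3 : x ^ 3 ≤ x ^ 2 / 250 := by nlinarith [sq_nonneg x]
  nlinarith

theorem arcsineMoment_half_sq_ge {s h : ℝ} (hs : 0 < s) (hs' : s ≤ 1 / 2) (hh : 2 ≤ h)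
    (hT : 60 ≤ 2 * s * h) :
    (1 - 60 / (2 * s * h)) * (2 * arcsineMoment s h ^ 2) ≤ arcsineMoment s (h / 2) ^ 2 := by
  have hTpos : 0 < 2 * s * h := by linarith
  have hx1' : 1 / (2 * s * h) ≤ 1 / 60 := one_div_le_one_div_of_le (by norm_num) hT
  have hc : 0 ≤ 1 - 30 * (1 / (2 * s * h)) := by linarith
  have key := two_mul_sq_le_arcsineMoment_half_sq hs hs' hh hc ?_
  · refine le_trans ?_ key
    gcongr
    have : 60 / (2 * s * h) = 60 * (1 / (2 * s * h)) := by ring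
    rw [this]
    nlinarith [sq_nonneg (1 / (2 * s * h))]
  · set T := 2 * s * h
    set x := 1 / T with hx
    have hx0 : 0 < x := by positivity
    have e1 : 1 + 1 / (4 * T) + 8 / T ^ 2 = 1 + x / 4 + 8 * x ^ 2 := by rw [hx]; field_simp
    have e2 : 1 + (1 / 2 - 3 * s) / T - 12 / T ^ 2 - 8 / T ^ 3 =
        1 + (1 / 2 - 3 * s) * x - 12 * x ^ 2 - 8 * x ^ 3 := by rw [hx]; field_simp
    rw [e1, e2]
    have h1 : (-1 : ℝ) * x ≤ (1 / 2 - 3 * s) * x := by gcongr; linarith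
    have h2 : x ^ 2 ≤ x / 60 := by nlinarith
    have h3 : 0 ≤ x ^ 3 := by positivity
    nlinarith

/-! ### Lower bounds for the second moment ratio -/

theorem half_le_evenProb {h n : ℕ} (hn : n = 2 * h) (p : ℝ) : 1 / 2 ≤ evenProb n p := by
  have : 0 ≤ (1 - 2 * p) ^ n := Even.pow_nonneg ⟨h, by omega⟩ _
  unfold evenProb; linarith

/-- Log-convexity bounds every base below by c, with `evenProb` ≥ 1/2 cancelling the 2; the weights
sum to 1. -/
theorem pow_le_secondMomentRatio {h n : ℕ} (hn : n = 2 * h) (m : ℕ) (p : unitInterval)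
    (hs' : (2 : ℝ) * p * (1 - p) ≤ 1 / 2) {c : ℝ} (hc : 0 ≤ c)
    (hle : c * (2 * arcsineMoment (2 * p * (1 - p)) h ^ 2) ≤
      arcsineMoment (2 * p * (1 - p)) (h / 2) ^ 2) :
    c ^ m ≤ secondMomentRatio m n p := by
  have he := half_le_evenProb hn p
  have hsum : c ^ m = ∑ k ∈ Finset.range (h + 1), overlapWeight h k * c ^ m := by
    rw [← Finset.sum_mul, sum_overlapWeight, one_mul]
  rw [secondMomentRatio_eq hn m p (by linarith) hs', hsum]
  refine Finset.sum_le_sum fun k hk => ?_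
  have hk' : k ≤ h := by simpa [Nat.lt_succ_iff] using hk
  refine mul_le_mul_of_nonneg_left ?_ (overlapWeight_nonneg h k)
  refine pow_le_pow_left₀ hc ?_ m
  set s : ℝ := 2 * p * (1 - p)
  have hf := arcsineMoment_pos hs' (t := (h : ℝ)) (by positivity)
  have h1 := arcsineMoment_half_sq_le hs' (a := (k : ℝ)) (b := ((h - k : ℕ) : ℝ)) (by positivity)
    (by positivity)
  have h2 : ((k : ℝ) + ((h - k : ℕ) : ℝ)) / 2 = h / 2 := by rw [Nat.cast_sub hk']; ring
  rw [h2] at h1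
  rw [le_div_iff₀ (by positivity)]
  calc c * arcsineMoment s h ^ 2 = 1 / 2 * (c * (2 * arcsineMoment s h ^ 2)) := by ring
    _ ≤ 1 / 2 * arcsineMoment s (h / 2) ^ 2 := by gcongr
    _ ≤ evenProb n p * (arcsineMoment s k * arcsineMoment s (h - k : ℕ)) := by gcongr

theorem exp_le_secondMomentRatio {n : ℕ} (hn : Even n) (m : ℕ) (p : unitInterval)
    (hp : (p : ℝ) ≤ 1 / 200) (hnp : 250 ≤ (n : ℝ) * p) :
    Real.exp (1 / 20 * ((m : ℝ) / (n * p))) ≤ secondMomentRatio m n p := by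
  obtain ⟨h, hh⟩ := hn
  have hn' : n = 2 * h := by omega
  have hp0 : (0 : ℝ) ≤ p := p.2.1
  have hnR : (n : ℝ) = 2 * h := by rw [hn']; push_cast; ring
  have hppos : (0 : ℝ) < p := by
    rcases hp0.eq_or_lt with h0 | h0
    · rw [← h0] at hnp; norm_num at hnp
    · exact h0
  have hs : (0 : ℝ) < 2 * p * (1 - p) := mul_pos (by positivity) (by linarith)
  have hs' : (2 : ℝ) * p * (1 - p) ≤ 1 / 100 := by nlinarith
  have hT1 : 2 * (2 * (p : ℝ) * (1 - p)) * h ≤ 2 * (n * p) := by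
    rw [hnR]; nlinarith [mul_nonneg (h.cast_nonneg (α := ℝ)) (sq_nonneg (p : ℝ))]
  have hT2 : (n : ℝ) * p ≤ 2 * (2 * (p : ℝ) * (1 - p)) * h := by
    have : (0 : ℝ) ≤ (h : ℝ) * p := by positivity
    rw [hnR]; nlinarith
  have hh2 : (2 : ℝ) ≤ h := by
    by_contra hlt
    push Not at hlt
    have : (n : ℝ) * p ≤ 4 * 1 := by
      rw [hnR]; exact mul_le_mul (by linarith) p.2.2 hp0 (by norm_num)
    linarith
  have key := arcsineMoment_half_sq_ge_sparse hs hs' hh2 (by linarith)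
  refine le_trans ?_ (pow_le_secondMomentRatio hn' m p (by linarith) (by positivity) key)
  set T := 2 * (2 * (p : ℝ) * (1 - p)) * h
  have hT0 : 0 < T := by linarith
  set x := 1 / (10 * T) with hx
  have hx0 : 0 < x := by positivity
  have hx1 : x ≤ 1 := by
    rw [hx, div_le_one (by positivity)]; linarith
  -- For 0 < x ≤ 1, exp x ≤ 1 + 2x.
  have h1 : Real.exp x ≤ (1 + x) ^ 2 := by
    have := Real.abs_exp_sub_one_le (x := x) (by rw [abs_of_pos hx0]; exact hx1)
    rw [abs_of_pos hx0] at this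
    have := (abs_le.1 this).2
    nlinarith
  calc Real.exp (1 / 20 * ((m : ℝ) / (n * p))) ≤ Real.exp (m * x) := by
        apply Real.exp_le_exp.2
        have h3 : 1 / (20 * ((n : ℝ) * p)) ≤ x := by
          apply one_div_le_one_div_of_le (by positivity); linarith
        calc 1 / 20 * ((m : ℝ) / (n * p)) = m * (1 / (20 * ((n : ℝ) * p))) := by
              rw [div_mul_div_comm, one_mul, mul_one_div]
          _ ≤ m * x := by gcongr
    _ = Real.exp x ^ m := Real.exp_nat_mul x m
    _ ≤ _ := by gcongr

theorem one_sub_le_secondMomentRatio {n : ℕ} (hn : Even n) (m : ℕ) (p : unitInterval)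
    (hp : (p : ℝ) ≤ 1 / 2) (hnp : 60 ≤ (n : ℝ) * p) :
    1 - 60 * ((m : ℝ) / (n * p)) ≤ secondMomentRatio m n p := by
  obtain ⟨h, hh⟩ := hn
  have hn' : n = 2 * h := by omega
  have hp0 : (0 : ℝ) ≤ p := p.2.1
  have hnR : (n : ℝ) = 2 * h := by rw [hn']; push_cast; ring
  have hppos : (0 : ℝ) < p := by
    rcases hp0.eq_or_lt with h0 | h0
    · rw [← h0] at hnp; norm_num at hnp
    · exact h0
  have hs : (0 : ℝ) < 2 * p * (1 - p) := mul_pos (by positivity) (by linarith)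
  have hs' : (2 : ℝ) * p * (1 - p) ≤ 1 / 2 := by nlinarith [sq_nonneg ((p : ℝ) - 1 / 2)]
  have hT2 : (n : ℝ) * p ≤ 2 * (2 * (p : ℝ) * (1 - p)) * h := by
    have : (0 : ℝ) ≤ (h : ℝ) * p := by positivity
    rw [hnR]; nlinarith
  have hh2 : (2 : ℝ) ≤ h := by
    by_contra hlt
    push Not at hlt
    have : (n : ℝ) * p ≤ 4 * 1 := by
      rw [hnR]; exact mul_le_mul (by linarith) p.2.2 hp0 (by norm_num)
    linarith
  have key := arcsineMoment_half_sq_ge hs hs' hh2 (by linarith)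
  set T := 2 * (2 * (p : ℝ) * (1 - p)) * h
  have hT0 : 0 < T := by linarith
  have hx1 : 60 / T ≤ 1 := by rw [div_le_one hT0]; linarith
  refine le_trans ?_ (pow_le_secondMomentRatio hn' m p hs' (by linarith) key)
  have hB := one_add_mul_le_pow (a := -(60 / T)) (by linarith) m
  have h3 : (m : ℝ) * (60 / T) ≤ m * (60 / (n * p)) := by gcongr
  calc 1 - 60 * ((m : ℝ) / (n * p)) = 1 - m * (60 / (n * p)) := by ring
    _ ≤ 1 + (m : ℝ) * (-(60 / T)) := by linarith
    _ ≤ (1 + -(60 / T)) ^ m := hB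
    _ = _ := by rw [← sub_eq_add_neg]

/-! ### Upper bound for the second moment ratio -/

theorem arcsineMoment_sq_ge {s h : ℝ} (hs : 0 < s) (hs' : s ≤ 1 / 2) (hh : 1 ≤ h)
    (hT : 10 ≤ 2 * s * h) :
    1 / (π * (2 * s * h)) * Real.exp (-(20 / (2 * s * h))) ≤ arcsineMoment s h ^ 2 := by
  have hpi := Real.pi_pos
  have h1 := le_arcsineMoment hs hs' hh
  set T := 2 * s * h
  have hTpos : 0 < T := by linarith
  set x := 1 / T with hx
  have hx0 : 0 < x := by positivity
  have hx1 : x ≤ 1 / 10 := one_div_le_one_div_of_le (by norm_num) hT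
  have e2 : 1 + (1 / 4 - 3 / 2 * s) / T - 3 / T ^ 2 - 1 / T ^ 3 =
      1 + (1 / 4 - 3 / 2 * s) * x - 3 * x ^ 2 - x ^ 3 := by rw [hx]; field_simp
  rw [e2] at h1
  have h2 : 1 - 5 * x ≤ 1 + (1 / 4 - 3 / 2 * s) * x - 3 * x ^ 2 - x ^ 3 := by
    have h1 : (-1 : ℝ) * x ≤ (1 / 4 - 3 / 2 * s) * x := by gcongr; linarith
    have h2 : x ^ 2 ≤ x / 10 := by nlinarith
    have h3 : x ^ 3 ≤ x ^ 2 / 10 := by nlinarith [sq_nonneg x]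
    nlinarith
  have h3 : Real.exp (-(10 * x)) ≤ 1 - 5 * x := by
    have h4 : 1 ≤ (1 - 5 * x) * Real.exp (10 * x) := by
      have := Real.add_one_le_exp (10 * x)
      nlinarith
    rw [Real.exp_neg, inv_eq_one_div, div_le_iff₀ (Real.exp_pos _)]
    exact h4
  have e3 : Real.exp (-(20 / T)) = Real.exp (-(10 * x)) ^ 2 := by
    rw [← Real.exp_nat_mul, hx]; congr 1; push_cast; ring
  rw [e3, ← inv_sqrt_sq (by positivity), ← mul_pow]
  gcongr
  refine le_trans ?_ h1
  gcongr
  exact h3.trans h2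

/-- The condition T/4 ≤ 2st is what |δ| ≤ 1/2 gives for t = k and t = h-k; then 36 = 9 · 4 from
1/(2st) ≤ 4/T. -/
theorem arcsineMoment_le_exp {s t T : ℝ} (hs : 0 < s) (hs' : s ≤ 1 / 2) (hT : 10 ≤ T)
    (ht : T / 4 ≤ 2 * s * t) :
    arcsineMoment s t ≤ 1 / √(π * (2 * s * t)) * Real.exp (36 / T) := by
  have hpi := Real.pi_pos
  have htpos : 0 < t := by
    by_contra hlt
    push Not at hlt
    nlinarith
  refine (arcsineMoment_le hs hs' htpos).trans ?_
  gcongr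
  set S := 2 * s * t
  have hS : 0 < S := by positivity
  set x := 1 / S with hx
  have hx0 : 0 < x := by positivity
  have hx1 : x ≤ 4 / T := by
    rw [hx, div_le_div_iff₀ hS (by linarith)]; linarith
  have hx2 : x ≤ 1 := by
    refine hx1.trans ?_
    rw [div_le_one (by linarith)]; linarith
  have e : 1 + 1 / (4 * S) + 8 / S ^ 2 = 1 + x / 4 + 8 * x ^ 2 := by rw [hx]; field_simp
  rw [e]
  have h1 := Real.add_one_le_exp (36 / T)
  have h2 : 36 / T = 9 * (4 / T) := by ring
  nlinarith

theorem evenProb_le {n : ℕ} {p T : ℝ} (hp : p ≤ 1 / 2) (hT : 0 < T)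
    (hTn : T ≤ 2 * (n * p)) : evenProb n p ≤ 1 / 2 * Real.exp (1 / T) := by
  have h1 : (1 - 2 * p) ^ n ≤ 1 / T := by
    calc (1 - 2 * p) ^ n ≤ Real.exp (-(2 * p)) ^ n := by
          refine pow_le_pow_left₀ (by linarith) ?_ n
          linarith [Real.add_one_le_exp (-(2 * p))]
      _ = Real.exp (-(2 * (n * p))) := by rw [← Real.exp_nat_mul]; ring_nf
      _ ≤ Real.exp (-T) := by gcongr
      _ = 1 / Real.exp T := by rw [Real.exp_neg, inv_eq_one_div]
      _ ≤ 1 / T := by gcongr; linarith [Real.add_one_le_exp T]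
  have h2 := Real.add_one_le_exp (1 / T)
  unfold evenProb
  linarith

/-- The summand of the overlap sum, near the centre. -/
theorem overlapTerm_le_center {h n : ℕ} (hn : n = 2 * h) {p : ℝ} (hp0 : 0 < p) (hp : p ≤ 1 / 2)
    {k : ℕ} (hk : k ≤ h) (hT : 10 ≤ 2 * (2 * p * (1 - p)) * h)
    (hδ : ((2 * k - h : ℝ) / h) ^ 2 ≤ 1 / 4) :
    evenProb n p * (arcsineMoment (2 * p * (1 - p)) (k : ℕ) *
        arcsineMoment (2 * p * (1 - p)) ((h - k : ℕ) : ℕ)) /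
          arcsineMoment (2 * p * (1 - p)) (h : ℕ) ^ 2 ≤
      Real.exp (93 / (2 * (2 * p * (1 - p)) * h)) *
        Real.exp (((2 * k - h : ℝ) / h) ^ 2) := by
  have hpi := Real.pi_pos
  have hs : 0 < 2 * p * (1 - p) := mul_pos (by positivity) (by linarith)
  have hs' : 2 * p * (1 - p) ≤ 1 / 2 := by nlinarith [sq_nonneg (p - 1 / 2)]
  have hnR : (n : ℝ) = 2 * h := by rw [hn]; push_cast; ring
  have hTn : 2 * (2 * p * (1 - p)) * h ≤ 2 * (n * p) := by
    rw [hnR]; nlinarith [mul_nonneg (h.cast_nonneg (α := ℝ)) (sq_nonneg p)]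
  set s := 2 * p * (1 - p)
  set δ := (2 * k - h : ℝ) / h with hδd
  have hh0 : (0 : ℝ) < h := by
    by_contra hlt
    push Not at hlt
    nlinarith
  have hh1 : (1 : ℝ) ≤ h := by exact_mod_cast Nat.one_le_iff_ne_zero.2 (by
    rintro rfl; simp at hh0)
  have hkδ : (k : ℝ) = h * (1 + δ) / 2 := by rw [hδd]; field_simp; ring
  have hkδ' : ((h - k : ℕ) : ℝ) = h * (1 - δ) / 2 := by
    rw [Nat.cast_sub hk, hkδ]; ring
  obtain ⟨hδ1, hδ2⟩ := abs_le.1 (abs_le_of_sq_le_sq (a := δ) (b := 1 / 2) (by linarith) (by norm_num))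
  set T := 2 * s * h with hTd
  have hT0 : 0 < T := by linarith
  have hA := arcsineMoment_le_exp hs hs' hT (t := (k : ℝ)) (by
    rw [hkδ]; have : 2 * s * (h * (1 + δ) / 2) = T * ((1 + δ) / 2) := by rw [hTd]; ring
    rw [this]; nlinarith)
  have hB := arcsineMoment_le_exp hs hs' hT (t := ((h - k : ℕ) : ℝ)) (by
    rw [hkδ']; have : 2 * s * (h * (1 - δ) / 2) = T * ((1 - δ) / 2) := by rw [hTd]; ring
    rw [this]; nlinarith)
  have hC := arcsineMoment_sq_ge hs hs' hh1 hT
  have hE := evenProb_le (n := n) hp hT0 hTn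
  have hE0 := half_le_evenProb hn p
  have hA0 := arcsineMoment_nonneg hs' (k : ℝ)
  have hB0 := arcsineMoment_nonneg hs' ((h - k : ℕ) : ℝ)
  set a := arcsineMoment s (k : ℝ)
  set b := arcsineMoment s ((h - k : ℕ) : ℝ)
  have hδ3 : 0 < 1 - δ ^ 2 := by linarith
  have hprod : 1 / √(π * (2 * s * k)) * (1 / √(π * (2 * s * ((h - k : ℕ) : ℝ)))) ≤
      2 / (π * T) * Real.exp (δ ^ 2) := by
    -- k(h-k) = h²(1-δ²)/4, and (1-δ²)^(-1/2) ≤ exp(δ²) for δ² ≤ 1/4.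
    have e1 : 1 / √(π * (2 * s * k)) * (1 / √(π * (2 * s * ((h - k : ℕ) : ℝ)))) =
        1 / √((π * T / 2) ^ 2 * (1 - δ ^ 2)) := by
      rw [one_div_mul_one_div, ← Real.sqrt_mul (by positivity), hkδ, hkδ', hTd]
      congr 2; ring
    rw [e1, Real.sqrt_mul (by positivity), Real.sqrt_sq (by positivity)]
    have e2 : 1 ≤ √(1 - δ ^ 2) * Real.exp (δ ^ 2) := by
      have h4 : (1 : ℝ) ≤ (1 - δ ^ 2) * Real.exp (δ ^ 2) ^ 2 := by
        rw [← Real.exp_nat_mul]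
        have := Real.add_one_le_exp ((2 : ℕ) * δ ^ 2)
        push_cast at this ⊢
        nlinarith [sq_nonneg δ]
      have h5 : (1 - δ ^ 2) * Real.exp (δ ^ 2) ^ 2 = (√(1 - δ ^ 2) * Real.exp (δ ^ 2)) ^ 2 := by
        rw [mul_pow, Real.sq_sqrt hδ3.le]
      rw [h5] at h4
      exact (one_le_sq_iff₀ (by positivity)).1 h4
    have h6 : 0 < √(1 - δ ^ 2) := Real.sqrt_pos.2 hδ3
    rw [div_le_iff₀ (by positivity)]
    calc (1 : ℝ) ≤ √(1 - δ ^ 2) * Real.exp (δ ^ 2) := e2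
      _ = _ := by field_simp
  -- 93 = 1 + 36 + 36 + 20: even-row probability, two numerator moments, denominator.
  have hexp : Real.exp (1 / T) * Real.exp (36 / T) * Real.exp (36 / T) =
      Real.exp (93 / T) * Real.exp (-(20 / T)) := by
    rw [← Real.exp_add, ← Real.exp_add, ← Real.exp_add]; congr 1; ring
  rw [div_le_iff₀ (lt_of_lt_of_le (by positivity) hC)]
  calc evenProb n p * (a * b) ≤ (1 / 2 * Real.exp (1 / T)) *
        ((1 / √(π * (2 * s * k)) * Real.exp (36 / T)) *
          (1 / √(π * (2 * s * ((h - k : ℕ) : ℝ))) * Real.exp (36 / T))) := by gcongr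
    _ = (1 / 2 * Real.exp (1 / T)) * (Real.exp (36 / T) * Real.exp (36 / T)) *
        (1 / √(π * (2 * s * k)) * (1 / √(π * (2 * s * ((h - k : ℕ) : ℝ))))) := by ring
    _ ≤ (1 / 2 * Real.exp (1 / T)) * (Real.exp (36 / T) * Real.exp (36 / T)) *
        (2 / (π * T) * Real.exp (δ ^ 2)) := by gcongr
    _ = (Real.exp (1 / T) * Real.exp (36 / T) * Real.exp (36 / T)) *
        Real.exp (δ ^ 2) * (1 / (π * T)) := by ring
    _ = (Real.exp (93 / T) * Real.exp (-(20 / T))) * Real.exp (δ ^ 2) * (1 / (π * T)) := by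
        rw [hexp]
    _ = Real.exp (93 / T) * Real.exp (δ ^ 2) * (1 / (π * T) * Real.exp (-(20 / T))) := by ring
    _ ≤ _ := by gcongr

/-- The summand of the overlap sum, crude bound. -/
theorem overlapTerm_le_crude {h n : ℕ} (hn : n = 2 * h) {p : ℝ} (hp0 : 0 < p) (hp : p ≤ 1 / 2)
    (k : ℕ) (hT : 20 ≤ 2 * (2 * p * (1 - p)) * h) :
    evenProb n p * (arcsineMoment (2 * p * (1 - p)) (k : ℕ) *
        arcsineMoment (2 * p * (1 - p)) ((h - k : ℕ) : ℕ)) /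
          arcsineMoment (2 * p * (1 - p)) (h : ℕ) ^ 2 ≤ 16 * h := by
  have hpi := Real.pi_pos
  have hs : 0 < 2 * p * (1 - p) := mul_pos (by positivity) (by linarith)
  have hs' : 2 * p * (1 - p) ≤ 1 / 2 := by nlinarith [sq_nonneg (p - 1 / 2)]
  have hE0 := half_le_evenProb hn p
  have hE1 : evenProb n p ≤ 1 := by
    have : (1 - 2 * p) ^ n ≤ 1 := pow_le_one₀ (by linarith) (by linarith)
    unfold evenProb; linarith
  set s := 2 * p * (1 - p)
  have hh0 : (0 : ℝ) < h := by
    by_contra hlt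
    push Not at hlt
    nlinarith
  have hh1 : (1 : ℝ) ≤ h := by exact_mod_cast Nat.one_le_iff_ne_zero.2 (by
    rintro rfl; simp at hh0)
  have hC := arcsineMoment_sq_ge hs hs' hh1 (by linarith)
  have hA0 := arcsineMoment_nonneg hs' (k : ℝ)
  have hB0 := arcsineMoment_nonneg hs' ((h - k : ℕ) : ℝ)
  have hA1 := arcsineMoment_le_one hs.le hs' (t := (k : ℝ)) (by positivity)
  have hB1 := arcsineMoment_le_one hs.le hs' (t := ((h - k : ℕ) : ℝ)) (by positivity)
  set T := 2 * s * h with hTd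
  have hT0 : 0 < T := by linarith
  have hTh : T ≤ h := by rw [hTd]; nlinarith
  rw [div_le_iff₀ (lt_of_lt_of_le (by positivity) hC)]
  have h1 : Real.exp (-1) ≤ Real.exp (-(20 / T)) := by
    apply Real.exp_le_exp.2
    have : 20 / T ≤ 1 := by rw [div_le_one hT0]; linarith
    linarith
  have h2 : (0.36 : ℝ) ≤ Real.exp (-1) := by
    have := Real.exp_neg_one_gt_d9; linarith
  have h3 : 1 ≤ 16 * h * (1 / (π * T) * Real.exp (-(20 / T))) := by
    have h4 : 1 / π ≤ h * (1 / (π * T)) := by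
      rw [mul_one_div, div_le_div_iff₀ hpi (by positivity)]; nlinarith
    have h5 : (1 : ℝ) / 4 ≤ 1 / π := one_div_le_one_div_of_le hpi Real.pi_le_four
    calc (1 : ℝ) ≤ 16 * (1 / 4) * 0.36 := by norm_num
      _ ≤ 16 * (h * (1 / (π * T))) * Real.exp (-(20 / T)) := by
          gcongr
          · exact h5.trans h4
          · exact h2.trans h1
      _ = _ := by ring
  calc evenProb n p * (arcsineMoment s k * arcsineMoment s ((h - k : ℕ) : ℝ))
      ≤ 1 * (1 * 1) := by gcongr
    _ ≤ 16 * h * (1 / (π * T) * Real.exp (-(20 / T))) := by linarith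
    _ ≤ _ := by gcongr

theorem secondMomentRatio_le {h m : ℕ} (hm : 1 ≤ m) {p : unitInterval} (hp0 : (0 : ℝ) < p)
    (hp : (p : ℝ) ≤ 1 / 2) (hT : 20 ≤ 2 * (2 * (p : ℝ) * (1 - p)) * h)
    (hmh : 32 * m * Real.log h ≤ h) :
    secondMomentRatio m (2 * h) p ≤ Real.exp (93 * (m / (2 * (2 * (p : ℝ) * (1 - p)) * h))) *
      (1 + 2 * (m / h) + 4 / h) + 4 / h := by
  have hs : (0 : ℝ) < 2 * p * (1 - p) := mul_pos (by positivity) (by linarith)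
  have hs' : (2 : ℝ) * p * (1 - p) ≤ 1 / 2 := by nlinarith [sq_nonneg ((p : ℝ) - 1 / 2)]
  have hE0 := half_le_evenProb (n := 2 * h) rfl p
  rw [secondMomentRatio_eq rfl m p (by linarith) hs']
  have hcent := fun k (hk : k ≤ h) => overlapTerm_le_center (n := 2 * h) rfl hp0 hp hk
    (by linarith)
  have hcrude := fun k => overlapTerm_le_crude (n := 2 * h) rfl hp0 hp k hT
  set s : ℝ := 2 * p * (1 - p)
  set T := 2 * s * h with hTd
  set X : ℕ → ℝ := fun k => evenProb (2 * h) p * (arcsineMoment s (k : ℕ) *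
        arcsineMoment s ((h - k : ℕ) : ℕ)) / arcsineMoment s (h : ℕ) ^ 2 with hX
  have hX0 : ∀ k, 0 ≤ X k := fun k => div_nonneg (mul_nonneg (by linarith)
    (mul_nonneg (arcsineMoment_nonneg hs' _) (arcsineMoment_nonneg hs' _))) (sq_nonneg _)
  have hTh : T ≤ h := by rw [hTd]; nlinarith [h.cast_nonneg (α := ℝ)]
  have hh20 : (20 : ℝ) ≤ h := hT.trans hTh
  have hh0 : (0 : ℝ) < h := by linarith
  have hhN : 1 ≤ h := by
    have : (1 : ℝ) ≤ h := by linarith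
    exact_mod_cast this
  have hmR : (1 : ℝ) ≤ m := by exact_mod_cast hm
  have hlog1 : 1 ≤ Real.log h := by
    rw [Real.le_log_iff_exp_le hh0]; linarith [Real.exp_one_lt_d9]
  set L := Real.log h with hL
  have hexpL : Real.exp L = h := Real.exp_log hh0
  have hm2 : 2 * (m : ℝ) ≤ h := by nlinarith
  have hLm : L ≤ m * L := by nlinarith
  -- the two exponentially small tails
  have hpow : ∀ j : ℕ, Real.exp (-(j * L)) = 1 / (h : ℝ) ^ j := by
    intro j
    rw [Real.exp_neg, Real.exp_nat_mul, hexpL, inv_eq_one_div]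
  have htail : 2 * h * ((h : ℝ) + 1) ≤ 4 * h ^ 2 := by nlinarith
  have hsmall : ∀ y : ℝ, y ≤ 1 / (h : ℝ) ^ 3 → 0 ≤ y → (h + 1) * (2 * h * y) ≤ 4 / h := by
    intro y hy hy0
    calc (h + 1) * (2 * h * y) = 2 * h * ((h : ℝ) + 1) * y := by ring
      _ ≤ 4 * h ^ 2 * (1 / (h : ℝ) ^ 3) := by gcongr
      _ = 4 / h := by field_simp
  -- Tail for mδ² > 1: since 2m ≤ h, exp(-(h-m)δ²) ≤ exp(-hδ²/2) ≤ `y₁`.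
  set y₁ := Real.exp (-(h / (2 * m))) with hy₁
  have hy₁le : y₁ ≤ 1 / (h : ℝ) ^ 3 := by
    rw [← hpow, hy₁]
    apply Real.exp_le_exp.2
    have : 16 * L ≤ h / (2 * m) := by
      rw [le_div_iff₀ (by positivity)]; linarith
    push_cast
    linarith
  -- Tail for δ² > 1/4: weight decay times the crude bound on the base.
  set y₂ := Real.exp (-(h / 4)) * (16 * h) ^ m with hy₂
  have hy₂le : y₂ ≤ 1 / (h : ℝ) ^ 3 := by
    rw [← hpow, hy₂]
    have h1 : (16 * (h : ℝ)) ^ m ≤ Real.exp (m * (2 * L)) := by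
      rw [Real.exp_nat_mul]
      gcongr
      have : Real.exp (2 * L) = h ^ 2 := by
        have := Real.exp_nat_mul L 2
        push_cast at this
        rw [this, hexpL]
      rw [this]; nlinarith
    calc _ ≤ Real.exp (-(h / 4)) * Real.exp (m * (2 * L)) := by gcongr
      _ = Real.exp (-(h / 4) + m * (2 * L)) := by rw [Real.exp_add]
      _ ≤ _ := by
        apply Real.exp_le_exp.2
        push_cast
        nlinarith
  set E := Real.exp (93 * (m / T)) with hE
  -- One majorant serves all three ranges of δ; the δ² term is later summed by the variance, the
  -- tails by `hsmall`.
  have hterm : ∀ k ∈ Finset.range (h + 1), overlapWeight h k * X k ^ m ≤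
      E * (overlapWeight h k + 2 * m * (overlapWeight h k * ((2 * k - h : ℝ) / h) ^ 2) +
        2 * h * y₁) + 2 * h * y₂ := by
    intro k hk
    have hk' : k ≤ h := by simpa [Nat.lt_succ_iff] using hk
    have hw := overlapWeight_nonneg h k
    have hw2 := overlapWeight_le hhN hk'
    set δ := (2 * k - h : ℝ) / h
    set w := overlapWeight h k
    have hy₁0 : 0 ≤ y₁ := (Real.exp_pos _).le
    have hy₂0 : 0 ≤ y₂ := by positivity
    have hE0' : 0 < E := Real.exp_pos _
    by_cases hδ : δ ^ 2 ≤ 1 / 4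
    · have h1 : X k ^ m ≤ E * Real.exp (m * δ ^ 2) := by
        have := pow_le_pow_left₀ (hX0 k) (hcent k hk' hδ) m
        rw [mul_pow, ← Real.exp_nat_mul, ← Real.exp_nat_mul] at this
        have e : (m : ℝ) * (93 / T) = 93 * (m / T) := by ring
        rwa [e] at this
      by_cases hmδ : m * δ ^ 2 ≤ 1
      · have h2 : Real.exp (m * δ ^ 2) ≤ 1 + 2 * (m * δ ^ 2) := by
          have h0 : 0 ≤ m * δ ^ 2 := by positivity
          have := Real.abs_exp_sub_one_le (x := m * δ ^ 2) (by rwa [abs_of_nonneg h0])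
          rw [abs_of_nonneg h0] at this
          linarith [(abs_le.1 this).2]
        calc w * X k ^ m ≤ w * (E * (1 + 2 * (m * δ ^ 2))) := by
              gcongr; exact h1.trans (by gcongr)
          _ = E * (w + 2 * m * (w * δ ^ 2)) := by ring
          _ ≤ E * (w + 2 * m * (w * δ ^ 2) + 2 * h * y₁) := by
              refine mul_le_mul_of_nonneg_left ?_ hE0'.le
              linarith [mul_nonneg (mul_nonneg zero_le_two hh0.le) hy₁0]
          _ ≤ _ := by linarith [mul_nonneg (mul_nonneg zero_le_two hh0.le) hy₂0]
      · push Not at hmδ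
        have h3 : Real.exp (-(h * δ ^ 2)) * Real.exp (m * δ ^ 2) ≤ y₁ := by
          rw [← Real.exp_add, hy₁]
          apply Real.exp_le_exp.2
          have h4 : (h : ℝ) / (2 * m) ≤ h / (2 * m) * (m * δ ^ 2) :=
            le_mul_of_one_le_right (by positivity) hmδ.le
          have h5 : h / (2 * m) * (m * δ ^ 2) = h / 2 * δ ^ 2 := by field_simp
          rw [h5] at h4
          nlinarith [sq_nonneg δ]
        calc w * X k ^ m ≤ (2 * h * Real.exp (-(h * δ ^ 2))) * (E * Real.exp (m * δ ^ 2)) :=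
              mul_le_mul hw2 h1 (pow_nonneg (hX0 k) m) (by positivity)
          _ = E * (2 * h * (Real.exp (-(h * δ ^ 2)) * Real.exp (m * δ ^ 2))) := by ring
          _ ≤ E * (2 * h * y₁) := by gcongr
          _ ≤ E * (w + 2 * m * (w * δ ^ 2) + 2 * h * y₁) := by
              refine mul_le_mul_of_nonneg_left ?_ hE0'.le
              linarith [mul_nonneg (mul_nonneg zero_le_two (by linarith : (0 : ℝ) ≤ m))
                (mul_nonneg hw (sq_nonneg δ))]
          _ ≤ _ := by linarith [mul_nonneg (mul_nonneg zero_le_two hh0.le) hy₂0]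
    · push Not at hδ
      have h3 : Real.exp (-(h * δ ^ 2)) ≤ Real.exp (-(h / 4)) := by
        apply Real.exp_le_exp.2; nlinarith
      have h4 : 0 ≤ E * (w + 2 * m * (w * δ ^ 2) + 2 * h * y₁) := by positivity
      calc w * X k ^ m ≤ (2 * h * Real.exp (-(h / 4))) * (16 * h) ^ m := by
            refine mul_le_mul (hw2.trans (by gcongr)) (pow_le_pow_left₀ (hX0 k) (hcrude k) m)
              (pow_nonneg (hX0 k) m) (by positivity)
        _ = 2 * h * y₂ := by rw [hy₂]; ring
        _ ≤ _ := by linarith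
  refine (Finset.sum_le_sum hterm).trans ?_
  rw [Finset.sum_add_distrib, ← Finset.mul_sum, Finset.sum_add_distrib, Finset.sum_add_distrib,
    ← Finset.mul_sum, sum_overlapWeight, sum_overlapWeight_mul_sq hhN]
  simp only [Finset.sum_const, Finset.card_range, nsmul_eq_mul]
  push_cast
  have h1 := hsmall y₁ hy₁le (Real.exp_pos _).le
  have h2 := hsmall y₂ hy₂le (by positivity)
  have h3 : 2 * (m : ℝ) * (1 / (2 * h - 1)) ≤ 2 * (m / h) := by
    have : 1 / (2 * (h : ℝ) - 1) ≤ 1 / h := one_div_le_one_div_of_le hh0 (by linarith)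
    calc 2 * (m : ℝ) * (1 / (2 * h - 1)) ≤ 2 * m * (1 / h) := by gcongr
      _ = _ := by ring
  gcongr

/-! ### Growth conditions -/

/-- If n/2 ≤ m², its logarithm is at most 2 log m; otherwise m ≤ √(n/2), and log x = o(√x) suffices.
-/
theorem eventually_mul_log_half_le {n : ℕ → ℕ}
    (hC : ∀ᶠ m : ℕ in atTop, 128 * (m : ℝ) * Real.log m ≤ n m)
    (hn : Tendsto (fun m : ℕ => (n m : ℝ)) atTop atTop) :
    ∀ᶠ m : ℕ in atTop, 32 * (m : ℝ) * Real.log ((n m : ℝ) / 2) ≤ (n m : ℝ) / 2 := by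
  have h1 : ∀ᶠ x : ℝ in atTop, 32 * Real.log x ≤ √x := by
    have := (isLittleO_log_rpow_atTop (r := 1 / 2) (by norm_num)).bound
      (show (0 : ℝ) < 1 / 32 by norm_num)
    filter_upwards [this, eventually_ge_atTop 1] with x hx hx1
    rw [Real.norm_of_nonneg (Real.log_nonneg hx1), Real.norm_of_nonneg (by positivity),
      ← Real.sqrt_eq_rpow] at hx
    linarith
  have hH : Tendsto (fun m : ℕ => (n m : ℝ) / 2) atTop atTop := hn.atTop_div_const (by norm_num)
  filter_upwards [hC, hH.eventually h1, hH.eventually_ge_atTop 1, eventually_ge_atTop 1]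
    with m hCm hlog hH1 hm
  have hm1 : (1 : ℝ) ≤ m := by exact_mod_cast hm
  have hHn : 64 * (m : ℝ) * Real.log m ≤ (n m : ℝ) / 2 := by linarith
  set H := (n m : ℝ) / 2
  have hlog0 : 0 ≤ Real.log H := Real.log_nonneg hH1
  by_cases hle : H ≤ (m : ℝ) ^ 2
  · have h2 : Real.log H ≤ 2 * Real.log m := by
      have := Real.log_le_log (by linarith) hle
      rwa [Real.log_pow, Nat.cast_ofNat] at this
    calc 32 * (m : ℝ) * Real.log H ≤ 32 * m * (2 * Real.log m) := by gcongr
      _ = 64 * m * Real.log m := by ring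
      _ ≤ H := hHn
  · push Not at hle
    have h3 : (m : ℝ) ≤ √H := Real.le_sqrt_of_sq_le hle.le
    calc 32 * (m : ℝ) * Real.log H = m * (32 * Real.log H) := by ring
      _ ≤ √H * √H := by gcongr
      _ = H := Real.mul_self_sqrt (by linarith)

/-- Since n ≥ 128 m log m, np ≤ Km gives p ≤ K/(128 log m). The implication sits inside the eventual
quantifier so that it applies to single values of m. -/
theorem eventually_le_of_mul_le {n : ℕ → ℕ} {p : ℕ → unitInterval}
    (hC : ∀ᶠ m : ℕ in atTop, 128 * (m : ℝ) * Real.log m ≤ n m) (K : ℝ) :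
    ∀ᶠ m : ℕ in atTop, (n m : ℝ) * p m ≤ K * m → (p m : ℝ) ≤ 1 / 200 := by
  have hlog : Tendsto (fun m : ℕ => Real.log (m : ℝ)) atTop atTop :=
    Real.tendsto_log_atTop.comp tendsto_natCast_atTop_atTop
  filter_upwards [hC, hlog.eventually_ge_atTop (2 * K), hlog.eventually_ge_atTop 1,
    eventually_ge_atTop 1] with m hCm hK hl hm hnp
  have hm1 : (1 : ℝ) ≤ m := by exact_mod_cast hm
  have hn0 : (0 : ℝ) < n m := by nlinarith
  have h1 : (n m : ℝ) * p m ≤ n m * (1 / 200) := by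
    have : K * m ≤ Real.log m / 2 * m := by gcongr; linarith
    have h0 : 0 ≤ (m : ℝ) * Real.log m := by positivity
    nlinarith
  exact le_of_mul_le_mul_left h1 hn0

theorem secondMomentRatio_le_of_even {n m : ℕ} (hn : Even n) (hm : 1 ≤ m) {p : unitInterval}
    (hp : (p : ℝ) ≤ 1 / 2) (hnp : 20 ≤ (n : ℝ) * p)
    (hmn : 32 * (m : ℝ) * Real.log ((n : ℝ) / 2) ≤ (n : ℝ) / 2) :
    secondMomentRatio m n p ≤ Real.exp (93 * ((m : ℝ) / (n * p))) *
      (1 + 4 * ((m : ℝ) / (n * p)) + 8 * (n * p : ℝ)⁻¹) + 8 * (n * p : ℝ)⁻¹ := by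
  obtain ⟨h, hh⟩ := hn
  obtain rfl : n = 2 * h := by omega
  have hp0 : (0 : ℝ) ≤ p := p.2.1
  have hp1 : (p : ℝ) ≤ 1 := p.2.2
  have hppos : (0 : ℝ) < p := by
    rcases hp0.eq_or_lt with h0 | h0
    · rw [← h0] at hnp; norm_num at hnp
    · exact h0
  push_cast at hnp hmn ⊢
  rw [mul_div_cancel_left₀ (h : ℝ) two_ne_zero] at hmn
  have hT : 2 * (h : ℝ) * p ≤ 2 * (2 * (p : ℝ) * (1 - p)) * h := by
    have : (0 : ℝ) ≤ (h : ℝ) * p := by positivity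
    nlinarith
  have hq : 2 * (h : ℝ) * p ≤ 2 * h := mul_le_of_le_one_right (by positivity) hp1
  refine (secondMomentRatio_le hm hppos hp (hnp.trans hT) hmn).trans ?_
  set q := 2 * (h : ℝ) * p
  have hq0 : 0 < q := by linarith
  have hh0 : (0 : ℝ) < h := by linarith
  have e1 : (m : ℝ) / (2 * (2 * (p : ℝ) * (1 - p)) * h) ≤ m / q := by gcongr
  have e2 : 2 * ((m : ℝ) / h) ≤ 4 * (m / q) := by
    have : (m : ℝ) / (2 * h) ≤ m / q := by gcongr
    calc 2 * ((m : ℝ) / h) = 4 * (m / (2 * h)) := by field_simp; norm_num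
      _ ≤ _ := by gcongr
  have e3 : 4 / (h : ℝ) ≤ 8 * q⁻¹ := by
    have : (2 * (h : ℝ))⁻¹ ≤ q⁻¹ := by gcongr
    calc 4 / (h : ℝ) = 8 * (2 * (h : ℝ))⁻¹ := by field_simp; norm_num
      _ ≤ _ := by gcongr
  gcongr

end DenseRegime

/-! ### The dichotomy between the dense and sparse regimes -/

theorem theorem5 :
    ∃ C : ℝ, 0 < C ∧ ∃ c : ℝ, 0 < c ∧
      ∀ (n : ℕ → ℕ) (p : ℕ → unitInterval),
        (∀ᶠ m : ℕ in atTop, Even (n m)) →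
        (∀ᶠ m : ℕ in atTop, (p m : ℝ) ≤ 1 / 2) →
        (∀ᶠ m : ℕ in atTop, C * (m : ℝ) * Real.log (m : ℝ) ≤ (n m : ℝ)) →
        Tendsto (fun m : ℕ => (n m : ℝ) * (p m : ℝ)) atTop atTop →
        -- dense case, `m = o(np)`: the ratio is `1 + o(1)`
        ((fun m : ℕ => (m : ℝ)) =o[atTop] (fun m : ℕ => (n m : ℝ) * (p m : ℝ)) →
          Tendsto (fun m : ℕ => DenseRegime.secondMomentRatio m (n m) (p m)) atTop (𝓝 1)) ∧
        -- sparse case, `m = Ω(np)`: the ratio is `exp(Ω(m / (np)))`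
        ((fun m : ℕ => (n m : ℝ) * (p m : ℝ)) =O[atTop] (fun m : ℕ => (m : ℝ)) →
          ∀ᶠ m : ℕ in atTop,
            Real.exp (c * ((m : ℝ) / ((n m : ℝ) * (p m : ℝ)))) ≤
              DenseRegime.secondMomentRatio m (n m) (p m)) ∧
        -- the second moment method succeeds only in the dense regime
        (Tendsto (fun m : ℕ => DenseRegime.secondMomentRatio m (n m) (p m)) atTop (𝓝 1) →
          (fun m : ℕ => (m : ℝ)) =o[atTop] (fun m : ℕ => (n m : ℝ) * (p m : ℝ))) := by
  -- 128 = 32 · 2 · 2: the tail bounds need 32, then come log h ≤ 2 log m and n = 2h. The 1/20 is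
  -- the gain 1/(10T) with T ≤ 2np.
  refine ⟨128, by norm_num, 1 / 20, by norm_num, fun n p hn hp hC hnp => ⟨?_, ?_, ?_⟩⟩
  · intro ho
    have hx := ho.tendsto_div_nhds_zero
    have hy := tendsto_inv_atTop_zero.comp hnp
    have hn' : Tendsto (fun m : ℕ => (n m : ℝ)) atTop atTop :=
      tendsto_atTop_mono (fun m => mul_le_of_le_one_right (Nat.cast_nonneg _) (p m).2.2) hnp
    have hlower : Tendsto (fun m : ℕ => 1 - 60 * ((m : ℝ) / ((n m : ℝ) * (p m : ℝ)))) atTop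
        (𝓝 1) := by
      simpa using (hx.const_mul 60).const_sub 1
    have hupper : Tendsto (fun m : ℕ => Real.exp (93 * ((m : ℝ) / ((n m : ℝ) * (p m : ℝ)))) *
        (1 + 4 * ((m : ℝ) / ((n m : ℝ) * (p m : ℝ))) + 8 * ((n m : ℝ) * (p m : ℝ))⁻¹) +
          8 * ((n m : ℝ) * (p m : ℝ))⁻¹) atTop (𝓝 1) := by
      have h1 := (Real.continuous_exp.tendsto _).comp (hx.const_mul 93)
      have h2 := ((hx.const_mul 4).const_add 1).add (hy.const_mul 8)
      simpa using (h1.mul h2).add (hy.const_mul 8)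
    refine tendsto_of_tendsto_of_tendsto_of_le_of_le' hlower hupper ?_ ?_
    · filter_upwards [hn, hp, hnp.eventually_ge_atTop 60] with m h1 h2 h3
      exact DenseRegime.one_sub_le_secondMomentRatio h1 m (p m) h2 h3
    · filter_upwards [hn, hp, hnp.eventually_ge_atTop 20, eventually_ge_atTop 1,
        DenseRegime.eventually_mul_log_half_le hC hn'] with m h1 h2 h3 h4 h5
      exact DenseRegime.secondMomentRatio_le_of_even h1 h4 h2 h3 h5
  · intro hO
    obtain ⟨K, hK⟩ := hO.bound
    filter_upwards [hn, hnp.eventually_ge_atTop 250, hK,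
      DenseRegime.eventually_le_of_mul_le (p := p) hC K] with m h1 h2 h3 h4
    refine DenseRegime.exp_le_secondMomentRatio h1 m (p m) (h4 ?_) h2
    rw [Real.norm_of_nonneg (by linarith), Real.norm_of_nonneg (by positivity)] at h3
    exact h3
  · intro ht
    refine isLittleO_iff.2 fun ε hε => ?_
    have hlt : (1 : ℝ) < Real.exp (1 / 20 * ε) := Real.one_lt_exp_iff.2 (by positivity)
    filter_upwards [hn, hnp.eventually_ge_atTop 250, ht.eventually_lt_const hlt,
      DenseRegime.eventually_le_of_mul_le (p := p) hC ε⁻¹] with m h1 h2 h3 h4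
    rw [Real.norm_of_nonneg (by positivity), Real.norm_of_nonneg (by linarith)]
    -- A single large m with m > ε np would make the ratio at least exp(ε/20), against convergence
    -- to 1.
    by_contra hlarge
    push Not at hlarge
    have h5 : (n m : ℝ) * p m ≤ ε⁻¹ * m := by
      rw [inv_mul_eq_div, le_div_iff₀ hε]; linarith
    have h6 := DenseRegime.exp_le_secondMomentRatio h1 m (p m) (h4 h5) h2
    have h7 : Real.exp (1 / 20 * ε) ≤ Real.exp (1 / 20 * ((m : ℝ) / (n m * p m))) := by
      apply Real.exp_le_exp.2
      gcongr
      rw [le_div_iff₀ (by linarith)]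
      exact hlarge.le
    linarith
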